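/- For an integer $n$ divisible by $4$, consider the partial communication problem $F_n\colon\{0,1\}^n\times\{0,1\}^n\to\{-1,+1,*\}$ given by $$F_n(x,y)=\begin{cases}-1 & \text{if } |x|=|y|=n/2 \text{ and } |x\cap y|=n/4,\\ +1 & \text{if } |x|=|y|=n/2 \text{ and } |x\cap y|=n/4-1,\\ * & \text{otherwise,}\end{cases}$$ where $|x|$ is the number of ones of $x$, $|x\cap y|$ is the number of positions in which both $x$ and $y$ have a one, and $*$ means that $F_n$ is undefined. Let $Q^*_{1/3}(F_n)$ denote the $1/3$-error quantum communication complexity of $F_n$ with arbitrary prior entanglement: the least number of qubits exchanged by a two-party quantum protocol whose players, Alice holding $x$ and Bob holding $y$, share in advance an arbitrary finite-dimensional entangled state that does not depend on the inputs, and whose output equals $F_n(x,y)$ with probability at least $2/3$ on every input $(x,y)$ where $F_n$ is defined (its behaviour on other inputs is arbitrary). Then $$Q^*_{1/3}(F_n)=\Omega(n),$$ that is, there are constants $c>0$ and $N$ such that $Q^*_{1/3}(F_n)\ge c\,n$ for all $n\ge N$ divisible by $4$. -/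

import Mathlib

open scoped NNReal ENNReal Matrix ComplexOrder

namespace QComm

/-- A two-party quantum communication protocol on classical inputs `x : X` (Alice) and `y : Y` (Bob),
to be run when Alice's register is the space `ℂ^a` and Bob's register is `ℂ^b`.
The order of the messages does not depend on the inputs, and each message is one qubit.
A player may, before sending, add ancillas to the register and apply a unitary, both depending on
the player's input: that is, apply an isometry.  At the end one of the players performs a
two-outcome measurement on the own register, given by the effect `E` of the outcome `-1`. -/
inductive Protocol (X Y : Type*) : ℕ → ℕ → Type _
  /-- Alice measures her register and announces `-1` (effect `E x`) or `+1` (effect `1 - E x`). -/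
  | aliceOutput {a b : ℕ} (E : X → Matrix (Fin a) (Fin a) ℂ)
      (hE : ∀ x, (E x).PosSemidef ∧ (1 - E x).PosSemidef) : Protocol X Y a b
  /-- Bob measures his register and announces `-1` (effect `E y`) or `+1` (effect `1 - E y`). -/
  | bobOutput {a b : ℕ} (E : Y → Matrix (Fin b) (Fin b) ℂ)
      (hE : ∀ y, (E y).PosSemidef ∧ (1 - E y).PosSemidef) : Protocol X Y a b
  /-- Alice applies the isometry `U x : ℂ^a → ℂ^a' ⊗ ℂ^2` and sends the last qubit to Bob. -/
  | aliceSend {a b a' : ℕ} (U : X → Matrix (Fin a' × Fin 2) (Fin a) ℂ)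
      (hU : ∀ x, (U x)ᴴ * U x = 1) (next : Protocol X Y a' (b * 2)) : Protocol X Y a b
  /-- Bob applies the isometry `V y : ℂ^b → ℂ^b' ⊗ ℂ^2` and sends the last qubit to Alice. -/
  | bobSend {a b b' : ℕ} (V : Y → Matrix (Fin b' × Fin 2) (Fin b) ℂ)
      (hV : ∀ y, (V y)ᴴ * V y = 1) (next : Protocol X Y (a * 2) b') : Protocol X Y a b

/-- The cost of a protocol: the number of qubits exchanged. -/
def Protocol.cost {X Y : Type*} : {a b : ℕ} → Protocol X Y a b → ℕ
  | _, _, .aliceOutput _ _ => 0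
  | _, _, .bobOutput _ _ => 0
  | _, _, .aliceSend _ _ next => next.cost + 1
  | _, _, .bobSend _ _ next => next.cost + 1

/-- The probability that the output is `-1` when the protocol is run on inputs `x`, `y` from the
joint state `M`.  A joint state `∑ i j, M i j • (e_i ⊗ e_j)` of the two registers is written as the
matrix `M`; so `S ⊗ I` acts as `M ↦ S * M` and `I ⊗ S` acts as `M ↦ M * Sᵀ`.
The register `ℂ^d ⊗ ℂ^2` of a player who has received a qubit is identified with `ℂ^(d * 2)`. -/
noncomputable def Protocol.probNeg {X Y : Type*} : {a b : ℕ} → Protocol X Y a b →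
    Matrix (Fin a) (Fin b) ℂ → X → Y → ℝ
  | _, _, .aliceOutput E _, M, x, _ => (Mᴴ * E x * M).trace.re
  | _, _, .bobOutput E _, M, _, y => (M * (E y)ᵀ * Mᴴ).trace.re
  | _, _, .aliceSend U _ next, M, x, y =>
      next.probNeg (Matrix.of fun i j =>
        (U x * M) (i, (finProdFinEquiv.symm j).2) (finProdFinEquiv.symm j).1) x y
  | _, _, .bobSend V _ next, M, x, y =>
      next.probNeg (Matrix.of fun i j =>
        (M * (V y)ᵀ) (finProdFinEquiv.symm i).1 (j, (finProdFinEquiv.symm i).2)) x y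

/-- A quantum protocol with prior entanglement: an arbitrary pure state of two finite-dimensional
registers (a unit vector of `ℂ^a ⊗ ℂ^b` that does not depend on the inputs), shared by Alice and
Bob in advance, together with a protocol that starts from it. -/
structure EntangledProtocol (X Y : Type*) where
  /-- The dimension of Alice's initial register. -/
  a : ℕ
  /-- The dimension of Bob's initial register. -/
  b : ℕ
  /-- The prior entangled state. -/
  state : Matrix (Fin a) (Fin b) ℂ
  unit_state : ∑ i, ∑ j, ‖state i j‖ ^ 2 = 1
  /-- The protocol that is run on this state. -/
  protocol : Protocol X Y a b

/-- The probability that an entangled protocol outputs `z ∈ {-1, +1}` on the inputs `x`, `y`. -/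
noncomputable def EntangledProtocol.outProb {X Y : Type*} (P : EntangledProtocol X Y)
    (x : X) (y : Y) (z : ℤˣ) : ℝ :=
  if z = -1 then P.protocol.probNeg P.state x y else 1 - P.protocol.probNeg P.state x y

/-- `P` computes the partial function `F : X × Y → {-1, +1, *}` (with `*` written `none`) with error
at most `ε`; nothing is asked on inputs where `F` is undefined. -/
def EntangledProtocol.Computes {X Y : Type*} (P : EntangledProtocol X Y)
    (F : X → Y → Option ℤˣ) (ε : ℝ) : Prop :=
  ∀ x y z, F x y = some z → 1 - ε ≤ P.outProb x y z

/-- `Q*_ε(F)`: the least number of qubits exchanged by a protocol with prior entanglement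
that computes `F` with error at most `ε`. -/
noncomputable def qStar {X Y : Type*} (ε : ℝ) (F : X → Y → Option ℤˣ) : ℕ∞ :=
  ⨅ (P : EntangledProtocol X Y) (_ : P.Computes F ε), (P.protocol.cost : ℕ∞)

/-- The Hamming weight `|x|`. -/
def weight {n : ℕ} (x : Fin n → Bool) : ℕ :=
  (Finset.univ.filter fun i => x i = true).card

/-- `|x ∩ y|`, the number of positions where both strings have a one. -/
def interCard {n : ℕ} (x y : Fin n → Bool) : ℕ :=
  (Finset.univ.filter fun i => x i = true ∧ y i = true).card

/-- The partial communication problem `F_n` (used for `n` divisible by `4`, where the divisions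
below are exact). -/
def gapInter (n : ℕ) (x y : Fin n → Bool) : Option ℤˣ :=
  if weight x = n / 2 ∧ weight y = n / 2 ∧ interCard x y = n / 4 then some (-1)
  else if weight x = n / 2 ∧ weight y = n / 2 ∧ interCard x y + 1 = n / 4 then some 1
  else none

end QComm

namespace QComm

section Contractions

open scoped Matrix.Norms.L2Operator

variable {l m n : Type*} [Fintype l] [Fintype m] [Fintype n]

/-- The squared Hilbert-Schmidt norm of a matrix. -/
noncomputable def hsSq (M : Matrix m n ℂ) : ℝ := ∑ i, ∑ j, ‖M i j‖ ^ 2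

lemma hsSq_conjTranspose (M : Matrix m n ℂ) : hsSq Mᴴ = hsSq M := by
  simp only [hsSq, Matrix.conjTranspose_apply, norm_star]
  exact Finset.sum_comm

lemma hsSq_mul_le [DecidableEq m] (C : Matrix l m ℂ) (M : Matrix m n ℂ) (hC : ‖C‖ ≤ 1) :
    hsSq (C * M) ≤ hsSq M := by
  unfold hsSq
  rw [Finset.sum_comm, Finset.sum_comm (f := fun i j => ‖M i j‖ ^ 2)]
  refine Finset.sum_le_sum fun j _ => ?_
  have h := Matrix.l2_opNorm_mulVec C (WithLp.toLp 2 fun i => M i j)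
  have h2 := h.trans (mul_le_of_le_one_left (norm_nonneg _) hC)
  have h3 := pow_le_pow_left₀ (norm_nonneg _) h2 2
  rw [EuclideanSpace.norm_sq_eq, EuclideanSpace.norm_sq_eq] at h3
  exact h3

lemma norm_mul_le_one [DecidableEq m] [DecidableEq n] {A : Matrix l m ℂ} {B : Matrix m n ℂ}
    (hA : ‖A‖ ≤ 1) (hB : ‖B‖ ≤ 1) : ‖A * B‖ ≤ 1 :=
  (Matrix.l2_opNorm_mul A B).trans (mul_le_one₀ hA (norm_nonneg _) hB)

lemma norm_one_matrix_le [DecidableEq n] : ‖(1 : Matrix n n ℂ)‖ ≤ 1 := by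
  rw [← Matrix.diagonal_one, Matrix.l2_opNorm_diagonal]
  exact (pi_norm_le_iff_of_nonneg zero_le_one).2 fun i => by simp

lemma norm_le_one_of_isometry [DecidableEq n] {U : Matrix m n ℂ} (h : Uᴴ * U = 1) : ‖U‖ ≤ 1 := by
  have := Matrix.l2_opNorm_conjTranspose_mul_self U
  rw [h] at this
  have h1 := norm_one_matrix_le (n := n)
  nlinarith [norm_nonneg U]

lemma norm_le_one_of_coisometry [DecidableEq m] [DecidableEq n] {U : Matrix m n ℂ}
    (h : U * Uᴴ = 1) : ‖U‖ ≤ 1 := by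
  rw [← Matrix.l2_opNorm_conjTranspose]
  exact norm_le_one_of_isometry (by rwa [Matrix.conjTranspose_conjTranspose])

open scoped MatrixOrder in
lemma norm_effect_le_one [DecidableEq n] {E : Matrix n n ℂ}
    (h : E.PosSemidef ∧ (1 - E).PosSemidef) : ‖E‖ ≤ 1 :=
  (CStarAlgebra.norm_le_one_iff_of_nonneg E (Matrix.nonneg_iff_posSemidef.2 h.1)).2
    (Matrix.le_iff.2 h.2)

lemma trace_conjTranspose_mul_self_re (M : Matrix m n ℂ) : (Mᴴ * M).trace.re = hsSq M := by
  simp only [Matrix.trace, Matrix.diag, Matrix.mul_apply, Matrix.conjTranspose_apply, hsSq,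
    Complex.re_sum]
  rw [Finset.sum_comm]
  refine Finset.sum_congr rfl fun i _ => Finset.sum_congr rfl fun j _ => ?_
  rw [← Complex.normSq_eq_norm_sq, Complex.star_def, mul_comm, Complex.mul_conj]
  simp

end Contractions

section Duality

variable {α β : Type*} [Fintype α] [Fintype β]

/-- The bilinear form of `Ψ` is bounded by `K` with respect to the Euclidean norms. -/
def BilinBound (Ψ : α → β → ℂ) (K : ℝ) : Prop :=
  ∀ (u : α → ℂ) (v : β → ℂ), ‖∑ i, ∑ j, Ψ i j * (u i * v j)‖ ≤
    K * (√(∑ i, ‖u i‖ ^ 2) * √(∑ j, ‖v j‖ ^ 2))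

lemma BilinBound.trace_le {Ψ : α → β → ℂ} {K : ℝ} (hΨ : BilinBound Ψ K) (hK : 0 ≤ K)
    {m n : Type*} [Fintype m] [Fintype n] (u : α → Matrix m n ℂ) (v : β → Matrix n m ℂ)
    (hu : ∀ i, hsSq (u i) ≤ 1) (hv : ∀ j, hsSq (v j) ≤ 1) :
    ‖∑ i, ∑ j, Ψ i j * (u i * v j).trace‖ ≤
      K * (√(Fintype.card α) * √(Fintype.card β)) := by
  have h1 : ∑ i, ∑ j, Ψ i j * (u i * v j).trace =
      ∑ p : m × n, ∑ i, ∑ j, Ψ i j * (u i p.1 p.2 * v j p.2 p.1) := by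
    rw [Finset.sum_comm (s := (Finset.univ : Finset (m × n)))]
    refine Finset.sum_congr rfl fun i _ => ?_
    rw [Finset.sum_comm (s := (Finset.univ : Finset (m × n)))]
    refine Finset.sum_congr rfl fun j _ => ?_
    simp only [Matrix.trace, Matrix.diag, Matrix.mul_apply, Finset.mul_sum,
      Fintype.sum_prod_type]
  rw [h1]
  calc _ ≤ ∑ p : m × n, K * (√(∑ i, ‖u i p.1 p.2‖ ^ 2) * √(∑ j, ‖v j p.2 p.1‖ ^ 2)) :=
        (norm_sum_le _ _).trans (Finset.sum_le_sum fun p _ =>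
          hΨ (fun i => u i p.1 p.2) (fun j => v j p.2 p.1))
    _ = K * ∑ p : m × n, √(∑ i, ‖u i p.1 p.2‖ ^ 2) * √(∑ j, ‖v j p.2 p.1‖ ^ 2) := by
        rw [Finset.mul_sum]
    _ ≤ K * (√(∑ p : m × n, ∑ i, ‖u i p.1 p.2‖ ^ 2) *
          √(∑ p : m × n, ∑ j, ‖v j p.2 p.1‖ ^ 2)) := by
        refine mul_le_mul_of_nonneg_left ?_ hK
        exact Real.sum_sqrt_mul_sqrt_le _ (fun _ => by positivity) (fun _ => by positivity)
    _ ≤ K * (√(Fintype.card α) * √(Fintype.card β)) := by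
        refine mul_le_mul_of_nonneg_left (mul_le_mul (Real.sqrt_le_sqrt ?_)
          (Real.sqrt_le_sqrt ?_) (Real.sqrt_nonneg _) (Real.sqrt_nonneg _)) hK
        · rw [Finset.sum_comm]
          calc _ ≤ ∑ _i : α, (1 : ℝ) := Finset.sum_le_sum fun i _ => by
                have := hu i
                rwa [hsSq, ← Fintype.sum_prod_type'] at this
            _ = _ := by simp
        · rw [Finset.sum_comm]
          calc _ ≤ ∑ _j : β, (1 : ℝ) := Finset.sum_le_sum fun j _ => by
                have := hv j
                rw [hsSq, Finset.sum_comm, ← Fintype.sum_prod_type'] at this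
                exact this
            _ = _ := by simp

end Duality

variable {X Y : Type*}

/-- The joint state after Alice applies `U` and sends her last qubit to Bob. -/
noncomputable def aliceMove {a b a' : ℕ} (U : Matrix (Fin a' × Fin 2) (Fin a) ℂ)
    (M : Matrix (Fin a) (Fin b) ℂ) : Matrix (Fin a') (Fin (b * 2)) ℂ :=
  Matrix.of fun i j => (U * M) (i, (finProdFinEquiv.symm j).2) (finProdFinEquiv.symm j).1

/-- The joint state after Bob applies `V` and sends his last qubit to Alice. -/
noncomputable def bobMove {a b b' : ℕ} (V : Matrix (Fin b' × Fin 2) (Fin b) ℂ)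
    (M : Matrix (Fin a) (Fin b) ℂ) : Matrix (Fin (a * 2)) (Fin b') ℂ :=
  Matrix.of fun i j => (M * Vᵀ) (finProdFinEquiv.symm i).1 (j, (finProdFinEquiv.symm i).2)

/-- The sesquilinear form whose quadratic form is the probability of the output `-1`. -/
noncomputable def Protocol.form : {a b : ℕ} → Protocol X Y a b →
    Matrix (Fin a) (Fin b) ℂ → Matrix (Fin a) (Fin b) ℂ → X → Y → ℂ
  | _, _, .aliceOutput E _, M, N, x, _ => (Mᴴ * E x * N).trace
  | _, _, .bobOutput E _, M, N, _, y => (N * (E y)ᵀ * Mᴴ).trace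
  | _, _, .aliceSend U _ next, M, N, x, y =>
      next.form (aliceMove (U x) M) (aliceMove (U x) N) x y
  | _, _, .bobSend V _ next, M, N, x, y =>
      next.form (bobMove (V y) M) (bobMove (V y) N) x y

lemma Protocol.probNeg_eq_form {a b : ℕ} (P : Protocol X Y a b) (M : Matrix (Fin a) (Fin b) ℂ)
    (x : X) (y : Y) : P.probNeg M x y = (P.form M M x y).re := by
  induction P with
  | aliceOutput E hE => rfl
  | bobOutput E hE => rfl
  | aliceSend U hU next ih => exact ih _
  | bobSend V hV next ih => exact ih _

lemma aliceMove_add {a b a' : ℕ} (U : Matrix (Fin a' × Fin 2) (Fin a) ℂ)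
    (M N : Matrix (Fin a) (Fin b) ℂ) : aliceMove U (M + N) = aliceMove U M + aliceMove U N := by
  ext i j; simp [aliceMove, Matrix.mul_add]

lemma bobMove_add {a b b' : ℕ} (V : Matrix (Fin b' × Fin 2) (Fin b) ℂ)
    (M N : Matrix (Fin a) (Fin b) ℂ) : bobMove V (M + N) = bobMove V M + bobMove V N := by
  ext i j; simp [bobMove, Matrix.add_mul]

lemma Protocol.form_add_left {a b : ℕ} (P : Protocol X Y a b) (M M' N : Matrix (Fin a) (Fin b) ℂ)
    (x : X) (y : Y) : P.form (M + M') N x y = P.form M N x y + P.form M' N x y := by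
  induction P with
  | aliceOutput E hE => simp [form, Matrix.add_mul]
  | bobOutput E hE => simp [form, Matrix.mul_add]
  | aliceSend U hU next ih => simp only [form, aliceMove_add, ih]
  | bobSend V hV next ih => simp only [form, bobMove_add, ih]

lemma Protocol.form_add_right {a b : ℕ} (P : Protocol X Y a b)
    (M N N' : Matrix (Fin a) (Fin b) ℂ) (x : X) (y : Y) :
    P.form M (N + N') x y = P.form M N x y + P.form M N' x y := by
  induction P with
  | aliceOutput E hE => simp [form, Matrix.mul_add]
  | bobOutput E hE => simp [form, Matrix.add_mul]
  | aliceSend U hU next ih => simp only [form, aliceMove_add, ih]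
  | bobSend V hV next ih => simp only [form, bobMove_add, ih]

/-- Projection of `ℂ^a ⊗ ℂ^2` to the component in which the qubit is `e_k`. -/
def qubitProj (a : ℕ) (k : Fin 2) : Matrix (Fin a) (Fin a × Fin 2) ℂ :=
  Matrix.of fun i j => if j = (i, k) then 1 else 0

/-- The transpose of the embedding `v ↦ v ⊗ e_k` of `ℂ^b` in `ℂ^b ⊗ ℂ^2 = ℂ^(b * 2)`. -/
def qubitEmb (b : ℕ) (k : Fin 2) : Matrix (Fin b) (Fin (b * 2)) ℂ :=
  Matrix.of fun i j => if finProdFinEquiv.symm j = (i, k) then 1 else 0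

section

open scoped Matrix.Norms.L2Operator

lemma norm_qubitProj_le (a : ℕ) (k : Fin 2) : ‖qubitProj a k‖ ≤ 1 := by
  refine norm_le_one_of_coisometry ?_
  ext i j
  simp [qubitProj, Matrix.mul_apply, Matrix.one_apply, eq_comm]

lemma norm_qubitEmb_le (b : ℕ) (k : Fin 2) : ‖qubitEmb b k‖ ≤ 1 := by
  refine norm_le_one_of_coisometry ?_
  ext i j
  rw [Matrix.mul_apply, ← Equiv.sum_comp finProdFinEquiv]
  simp only [qubitEmb, Matrix.of_apply, Equiv.symm_apply_apply, Matrix.conjTranspose_apply,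
    Matrix.one_apply]
  simp [apply_ite, eq_comm]

lemma norm_transpose_isometry_le {m n : Type*} [Fintype m] [Fintype n] [DecidableEq m]
    [DecidableEq n] {V : Matrix m n ℂ} (h : Vᴴ * V = 1) : ‖Vᵀ‖ ≤ 1 := by
  refine norm_le_one_of_coisometry ?_
  have := congrArg Matrix.transpose h
  rwa [Matrix.transpose_mul, Matrix.transpose_one] at this

end

lemma aliceMove_eq {a b a' : ℕ} (U : Matrix (Fin a' × Fin 2) (Fin a) ℂ)
    (M : Matrix (Fin a) (Fin b) ℂ) :
    aliceMove U M = qubitProj a' 0 * U * M * qubitEmb b 0 +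
      qubitProj a' 1 * U * M * qubitEmb b 1 := by
  have key : ∀ k : Fin 2, ∀ i j, (qubitProj a' k * U * M * qubitEmb b k) i j =
      if (finProdFinEquiv.symm j).2 = k then (U * M) (i, k) (finProdFinEquiv.symm j).1 else 0 := by
    intro k i j
    rw [Matrix.mul_assoc (qubitProj a' k), Matrix.mul_apply]
    have : ∀ r, (qubitProj a' k * (U * M)) i r = (U * M) (i, k) r := by
      intro r; rw [Matrix.mul_apply]; simp [qubitProj]
    simp only [this, qubitEmb, Matrix.of_apply]
    generalize finProdFinEquiv.symm j = p
    simp only [Prod.ext_iff]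
    split_ifs with h <;> simp [h]
  ext i j
  rw [Matrix.add_apply, key, key, aliceMove, Matrix.of_apply]
  generalize (finProdFinEquiv.symm j) = p
  obtain ⟨p, k⟩ := p
  fin_cases k <;> simp

lemma bobMove_eq {a b b' : ℕ} (V : Matrix (Fin b' × Fin 2) (Fin b) ℂ)
    (M : Matrix (Fin a) (Fin b) ℂ) :
    bobMove V M = (qubitEmb a 0)ᴴ * M * (Vᵀ * (qubitProj b' 0)ᴴ) +
      (qubitEmb a 1)ᴴ * M * (Vᵀ * (qubitProj b' 1)ᴴ) := by
  have key : ∀ k : Fin 2, ∀ i j, ((qubitEmb a k)ᴴ * M * (Vᵀ * (qubitProj b' k)ᴴ)) i j =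
      if (finProdFinEquiv.symm i).2 = k then (M * Vᵀ) (finProdFinEquiv.symm i).1 (j, k) else 0 := by
    intro k i j
    rw [Matrix.mul_assoc (qubitEmb a k)ᴴ, ← Matrix.mul_assoc M, Matrix.mul_apply]
    have : ∀ r, (M * Vᵀ * (qubitProj b' k)ᴴ) r j = (M * Vᵀ) r (j, k) := by
      intro r; rw [Matrix.mul_apply]; simp [qubitProj, apply_ite]
    simp only [this, qubitEmb, Matrix.conjTranspose_apply, Matrix.of_apply]
    generalize finProdFinEquiv.symm i = p
    simp only [Prod.ext_iff]
    split_ifs with h <;> simp [h, apply_ite]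
  ext i j
  rw [Matrix.add_apply, key, key, bobMove, Matrix.of_apply]
  generalize (finProdFinEquiv.symm i) = p
  obtain ⟨p, k⟩ := p
  fin_cases k <;> simp

section

open scoped Matrix.Norms.L2Operator

lemma norm_sum_four_le {α β : Type*} [Fintype α] [Fintype β] (Ψ : α → β → ℂ)
    (F : Fin 2 → Fin 2 → α → β → ℂ) {c : ℝ}
    (h : ∀ k l, ‖∑ i, ∑ j, Ψ i j * F k l i j‖ ≤ c) :
    ‖∑ i, ∑ j, Ψ i j * ∑ k, ∑ l, F k l i j‖ ≤ 4 * c := by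
  have e : ∑ i, ∑ j, Ψ i j * ∑ k, ∑ l, F k l i j =
      ∑ k, ∑ l, ∑ i, ∑ j, Ψ i j * F k l i j := by
    simp only [Fin.sum_univ_two, mul_add, Finset.sum_add_distrib]
  rw [e]
  refine (norm_sum_le_of_le _ fun k _ => norm_sum_le_of_le _ fun l _ => h k l).trans
    (le_of_eq ?_)
  simp only [Fin.sum_univ_two]
  ring

/-- A `q`-qubit protocol, run on states that arise from a fixed state by local contractions, has
correlation at most `4 ^ q` times the spectral bound with any `Ψ`. -/
theorem Protocol.form_correlation_le {α β : Type*} [Fintype α] [Fintype β] {Ψ : α → β → ℂ} {K : ℝ}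
    (hΨ : BilinBound Ψ K) (hK : 0 ≤ K) (f : α → X) (g : β → Y) {a₀ b₀ : ℕ}
    (ψ : Matrix (Fin a₀) (Fin b₀) ℂ) (hψ : hsSq ψ ≤ 1) {a b : ℕ} (P : Protocol X Y a b)
    (A A' : α → Matrix (Fin a) (Fin a₀) ℂ) (B B' : β → Matrix (Fin b₀) (Fin b) ℂ)
    (hA : ∀ i, ‖A i‖ ≤ 1) (hA' : ∀ i, ‖A' i‖ ≤ 1) (hB : ∀ j, ‖B j‖ ≤ 1) (hB' : ∀ j, ‖B' j‖ ≤ 1) :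
    ‖∑ i, ∑ j, Ψ i j * P.form (A i * ψ * B j) (A' i * ψ * B' j) (f i) (g j)‖ ≤
      4 ^ P.cost * (K * (√(Fintype.card α) * √(Fintype.card β))) := by
  induction P with
  | aliceOutput E hE =>
    have h := hΨ.trace_le hK (fun i => (A i)ᴴ * E (f i) * A' i * ψ) (fun j => B' j * (B j)ᴴ * ψᴴ)
      (fun i => (hsSq_mul_le _ _ (norm_mul_le_one (norm_mul_le_one
        (by rw [Matrix.l2_opNorm_conjTranspose]; exact hA i) (norm_effect_le_one (hE _)))
        (hA' i))).trans hψ)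
      (fun j => (hsSq_mul_le _ _ (norm_mul_le_one (hB' j)
        (by rw [Matrix.l2_opNorm_conjTranspose]; exact hB j))).trans
          (by rwa [hsSq_conjTranspose]))
    simp only [cost, pow_zero, one_mul]
    convert h using 7 with i _ j _
    simp only [form, Matrix.conjTranspose_mul]
    rw [Matrix.mul_assoc, Matrix.mul_assoc, Matrix.trace_mul_comm]
    simp only [Matrix.mul_assoc]
    rw [Matrix.trace_mul_comm]
    simp only [Matrix.mul_assoc]
  | bobOutput E hE =>
    have h := hΨ.trace_le hK (fun i => (A i)ᴴ * A' i * ψ)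
      (fun j => B' j * (E (g j))ᵀ * (B j)ᴴ * ψᴴ)
      (fun i => (hsSq_mul_le _ _ (norm_mul_le_one
        (by rw [Matrix.l2_opNorm_conjTranspose]; exact hA i) (hA' i))).trans hψ)
      (fun j => (hsSq_mul_le _ _ (norm_mul_le_one (norm_mul_le_one (hB' j)
        (norm_effect_le_one ⟨(hE _).1.transpose, by
          simpa using (hE (g j)).2.transpose⟩))
        (by rw [Matrix.l2_opNorm_conjTranspose]; exact hB j))).trans
          (by rwa [hsSq_conjTranspose]))
    simp only [cost, pow_zero, one_mul]
    convert h using 7 with i _ j _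
    simp only [form, Matrix.conjTranspose_mul]
    rw [Matrix.trace_mul_comm]
    simp only [Matrix.mul_assoc]
    rw [Matrix.trace_mul_comm]
    simp only [Matrix.mul_assoc]
    rw [Matrix.trace_mul_comm]
    simp only [Matrix.mul_assoc]
  | @aliceSend a b a' U hU next ih =>
    have hU' : ∀ x, ‖U x‖ ≤ 1 := fun x => norm_le_one_of_isometry (hU x)
    have hAk : ∀ (D : α → Matrix (Fin a) (Fin a₀) ℂ), (∀ i, ‖D i‖ ≤ 1) → ∀ (k : Fin 2) i,
      ‖qubitProj a' k * U (f i) * D i‖ ≤ 1 := fun D hD k i =>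
        norm_mul_le_one (norm_mul_le_one (norm_qubitProj_le _ _) (hU' _)) (hD i)
    have hBk : ∀ (D : β → Matrix (Fin b₀) (Fin b) ℂ), (∀ j, ‖D j‖ ≤ 1) → ∀ (k : Fin 2) j,
      ‖D j * qubitEmb b k‖ ≤ 1 := fun D hD k j => norm_mul_le_one (hD j) (norm_qubitEmb_le _ _)
    have hkl := norm_sum_four_le Ψ _ fun k l : Fin 2 =>
      ih _ _ _ _ (hAk A hA k) (hAk A' hA' l) (hBk B hB k) (hBk B' hB' l)
    rw [cost, pow_succ', mul_assoc]
    convert hkl using 7 with i _ j _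
    simp only [form, aliceMove_eq, form_add_left, form_add_right, Fin.sum_univ_two,
      Matrix.mul_assoc]
    ring
  | @bobSend a b b' V hV next ih =>
    have hV' : ∀ y, ‖(V y)ᵀ‖ ≤ 1 := fun y => norm_transpose_isometry_le (hV y)
    have hAk : ∀ (D : α → Matrix (Fin a) (Fin a₀) ℂ), (∀ i, ‖D i‖ ≤ 1) → ∀ (k : Fin 2) i,
      ‖(qubitEmb a k)ᴴ * D i‖ ≤ 1 := fun D hD k i =>
        norm_mul_le_one (by rw [Matrix.l2_opNorm_conjTranspose]; exact norm_qubitEmb_le _ _) (hD i)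
    have hBk : ∀ (D : β → Matrix (Fin b₀) (Fin b) ℂ), (∀ j, ‖D j‖ ≤ 1) → ∀ (k : Fin 2) j,
      ‖D j * ((V (g j))ᵀ * (qubitProj b' k)ᴴ)‖ ≤ 1 := fun D hD k j =>
        norm_mul_le_one (hD j) (norm_mul_le_one (hV' _)
          (by rw [Matrix.l2_opNorm_conjTranspose]; exact norm_qubitProj_le _ _))
    have hkl := norm_sum_four_le Ψ _ fun k l : Fin 2 =>
      ih _ _ _ _ (hAk A hA k) (hAk A' hA' l) (hBk B hB k) (hBk B' hB' l)
    rw [cost, pow_succ', mul_assoc]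
    convert hkl using 7 with i _ j _
    simp only [form, bobMove_eq, form_add_left, form_add_right, Fin.sum_univ_two,
      Matrix.mul_assoc]
    ring

/-- The acceptance probabilities of a `q`-qubit protocol have correlation at most `4 ^ q` times the
spectral bound with any `Ψ`. -/
theorem Protocol.probNeg_correlation_le {α β : Type*} [Fintype α] [Fintype β] {Ψ : α → β → ℝ}
    {K : ℝ} (hΨ : BilinBound (fun i j => (Ψ i j : ℂ)) K) (hK : 0 ≤ K) (f : α → X) (g : β → Y)
    {a b : ℕ} (P : Protocol X Y a b) (ψ : Matrix (Fin a) (Fin b) ℂ) (hψ : hsSq ψ ≤ 1) :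
    |∑ i, ∑ j, Ψ i j * P.probNeg ψ (f i) (g j)| ≤
      4 ^ P.cost * (K * (√(Fintype.card α) * √(Fintype.card β))) := by
  have h := P.form_correlation_le hΨ hK f g ψ hψ (fun _ => 1) (fun _ => 1) (fun _ => 1)
    (fun _ => 1) (fun _ => norm_one_matrix_le) (fun _ => norm_one_matrix_le)
    (fun _ => norm_one_matrix_le) (fun _ => norm_one_matrix_le)
  refine le_trans (le_of_eq_of_le ?_ (Complex.abs_re_le_norm _)) h
  simp only [Complex.re_sum, Complex.re_ofReal_mul, Matrix.one_mul, Matrix.mul_one,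
    probNeg_eq_form]

end

lemma hsSq_aliceMove {a b a' : ℕ} {U : Matrix (Fin a' × Fin 2) (Fin a) ℂ} (hU : Uᴴ * U = 1)
    (M : Matrix (Fin a) (Fin b) ℂ) : hsSq (aliceMove U M) = hsSq M := by
  have h1 : hsSq (aliceMove U M) = hsSq (U * M) := by
    simp only [hsSq, aliceMove, Matrix.of_apply, Fintype.sum_prod_type]
    refine Finset.sum_congr rfl fun i _ => ?_
    rw [← Equiv.sum_comp finProdFinEquiv]
    simp only [Equiv.symm_apply_apply, Fintype.sum_prod_type]
    exact Finset.sum_comm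
  rw [h1, ← trace_conjTranspose_mul_self_re, ← trace_conjTranspose_mul_self_re,
    Matrix.conjTranspose_mul, Matrix.mul_assoc, ← Matrix.mul_assoc Uᴴ, hU, Matrix.one_mul]

lemma bobMove_eq_transpose {a b b' : ℕ} (V : Matrix (Fin b' × Fin 2) (Fin b) ℂ)
    (M : Matrix (Fin a) (Fin b) ℂ) : bobMove V M = (aliceMove V Mᵀ)ᵀ := by
  ext i j
  simp only [bobMove, aliceMove, Matrix.of_apply, Matrix.transpose_apply]
  rw [← Matrix.transpose_apply (M * Vᵀ), Matrix.transpose_mul, Matrix.transpose_transpose]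

lemma hsSq_transpose {m n : Type*} [Fintype m] [Fintype n] (M : Matrix m n ℂ) :
    hsSq Mᵀ = hsSq M := by
  simp only [hsSq, Matrix.transpose_apply]
  exact Finset.sum_comm

lemma hsSq_bobMove {a b b' : ℕ} {V : Matrix (Fin b' × Fin 2) (Fin b) ℂ} (hV : Vᴴ * V = 1)
    (M : Matrix (Fin a) (Fin b) ℂ) : hsSq (bobMove V M) = hsSq M := by
  rw [bobMove_eq_transpose, hsSq_transpose, hsSq_aliceMove hV, hsSq_transpose]

lemma Protocol.probNeg_nonneg {a b : ℕ} (P : Protocol X Y a b) (M : Matrix (Fin a) (Fin b) ℂ)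
    (x : X) (y : Y) : 0 ≤ P.probNeg M x y := by
  induction P with
  | aliceOutput E hE =>
    exact (Complex.le_def.1 ((hE x).1.conjTranspose_mul_mul_same M).trace_nonneg).1
  | bobOutput E hE =>
    exact (Complex.le_def.1 ((hE y).1.transpose.mul_mul_conjTranspose_same M).trace_nonneg).1
  | aliceSend U hU next ih => exact ih _
  | bobSend V hV next ih => exact ih _

lemma Protocol.probNeg_le {a b : ℕ} (P : Protocol X Y a b) (M : Matrix (Fin a) (Fin b) ℂ)
    (x : X) (y : Y) : P.probNeg M x y ≤ hsSq M := by
  induction P with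
  | aliceOutput E hE =>
    have h := (Complex.le_def.1 ((hE x).2.conjTranspose_mul_mul_same M).trace_nonneg).1
    rw [Matrix.mul_sub, Matrix.sub_mul, Matrix.trace_sub, Matrix.mul_one, Complex.sub_re,
      trace_conjTranspose_mul_self_re] at h
    exact sub_nonneg.1 h
  | bobOutput E hE =>
    have h := (Complex.le_def.1 ((hE y).2.transpose.mul_mul_conjTranspose_same M).trace_nonneg).1
    rw [Matrix.transpose_sub, Matrix.transpose_one, Matrix.mul_sub, Matrix.sub_mul,
      Matrix.trace_sub, Matrix.mul_one, Complex.sub_re, Matrix.trace_mul_comm M,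
      trace_conjTranspose_mul_self_re] at h
    exact sub_nonneg.1 h
  | aliceSend U hU next ih => exact (ih _).trans_eq (hsSq_aliceMove (hU x) M)
  | bobSend V hV next ih => exact (ih _).trans_eq (hsSq_bobMove (hV y) M)

/-- The sign `(-1)^b` of a bit. -/
def bitSign (b : Bool) : ℝ := if b then -1 else 1

lemma bitSign_xor (a b : Bool) : bitSign (xor a b) = bitSign a * bitSign b := by
  cases a <;> cases b <;> simp [bitSign]

/-- The character of the Boolean cube indexed by the set `S`. -/
def cubeChar {ι : Type*} (S : Finset ι) (x : ι → Bool) : ℝ := ∏ i ∈ S, bitSign (x i)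

section Fourier

variable {ι : Type*}

lemma cubeChar_xor (S : Finset ι) (x y : ι → Bool) :
    cubeChar S (fun i => xor (x i) (y i)) = cubeChar S x * cubeChar S y := by
  simp [cubeChar, bitSign_xor, Finset.prod_mul_distrib]

lemma sum_cubeChar_mul [Fintype ι] (x y : ι → Bool) :
    ∑ S : Finset ι, cubeChar S x * cubeChar S y = if x = y then 2 ^ Fintype.card ι else 0 := by
  simp only [cubeChar, ← Finset.prod_mul_distrib]
  rw [← Finset.powerset_univ, ← Finset.prod_one_add]
  split_ifs with h
  · subst h
    rw [Finset.prod_congr rfl (g := fun _ => (2 : ℝ)) fun i _ => by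
      cases x i <;> norm_num [bitSign]]
    simp
  · obtain ⟨i, hi⟩ := Function.ne_iff.1 h
    refine Finset.prod_eq_zero (Finset.mem_univ i) ?_
    revert hi
    cases x i <;> cases y i <;> simp [bitSign]

/-- Parseval's identity on the Boolean cube. -/
lemma sum_norm_sq_transform [Fintype ι] [DecidableEq ι] (u : (ι → Bool) → ℂ) :
    ∑ S : Finset ι, ‖∑ x, (cubeChar S x : ℂ) * u x‖ ^ 2 =
      2 ^ Fintype.card ι * ∑ x, ‖u x‖ ^ 2 := by
  have h : ∀ z : ℂ, ((‖z‖ ^ 2 : ℝ) : ℂ) = z * (starRingEnd ℂ) z := fun z => by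
    rw [Complex.mul_conj, Complex.normSq_eq_norm_sq]
  apply Complex.ofReal_injective
  rw [Complex.ofReal_sum, Complex.ofReal_mul, Complex.ofReal_sum]
  simp only [h, map_sum, map_mul, Complex.conj_ofReal, Finset.sum_mul_sum]
  rw [Finset.sum_comm, Finset.mul_sum]
  refine Finset.sum_congr rfl fun x _ => ?_
  rw [Finset.sum_comm]
  have : ∀ y, ∑ S : Finset ι, (cubeChar S x : ℂ) * u x * (cubeChar S y * (starRingEnd ℂ) (u y)) =
      (if x = y then 2 ^ Fintype.card ι else 0) * (u x * (starRingEnd ℂ) (u y)) := by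
    intro y
    have := congrArg (Complex.ofReal) (sum_cubeChar_mul x y)
    rw [apply_ite Complex.ofReal] at this
    push_cast at this
    rw [← this, Finset.sum_mul]
    exact Finset.sum_congr rfl fun S _ => by ring
  simp only [this]
  simp

lemma eq_sum_transform [Fintype ι] [DecidableEq ι] (φ : (ι → Bool) → ℝ) (z : ι → Bool) :
    φ z = (2 ^ Fintype.card ι)⁻¹ * ∑ S : Finset ι, (∑ x, φ x * cubeChar S x) * cubeChar S z := by
  have : ∑ S : Finset ι, (∑ x, φ x * cubeChar S x) * cubeChar S z =
      ∑ x, φ x * ∑ S : Finset ι, cubeChar S x * cubeChar S z := by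
    simp only [Finset.sum_mul, Finset.mul_sum]
    rw [Finset.sum_comm]
    simp only [mul_assoc]
  rw [this]
  simp [sum_cubeChar_mul]
  field_simp

/-- The points `(i, V i)` selected by `V` over `S`. -/
def selection [DecidableEq ι] (V : ι → Bool) (S : Finset ι) : Finset (ι × Bool) :=
  S.image fun i => (i, V i)

lemma cubeChar_selection [DecidableEq ι] (V : ι → Bool) (S : Finset ι) (x : ι × Bool → Bool) :
    cubeChar (selection V S) x = cubeChar S fun i => x (i, V i) := by
  rw [cubeChar, selection, Finset.prod_image fun i _ j _ h => (Prod.ext_iff.1 h).1]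
  rfl

lemma card_selection_fiber_le [Fintype ι] [DecidableEq ι] (d : ℕ) (T : Finset (ι × Bool)) :
    (Finset.univ.filter fun p : (ι → Bool) × Finset ι =>
      d ≤ p.2.card ∧ selection p.1 p.2 = T).card ≤ 2 ^ (Fintype.card ι - d) := by
  have hS : ∀ p : (ι → Bool) × Finset ι, selection p.1 p.2 = T → p.2 = T.image Prod.fst := by
    rintro ⟨V, S⟩ rfl
    simp [selection, Finset.image_image, Function.comp_def]
  by_cases hd : d ≤ (T.image Prod.fst).card
  · calc _ ≤ ((T.image Prod.fst)ᶜ.powerset).card := by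
          refine Finset.card_le_card_of_injOn
            (fun p => (T.image Prod.fst)ᶜ.filter fun i => p.1 i = true) ?_ ?_
          · intro p _
            exact Finset.mem_powerset.2 (Finset.filter_subset _ _)
          · rintro ⟨V, S⟩ hp ⟨V', S'⟩ hp' h
            simp only [Finset.coe_filter, Finset.mem_univ, true_and, Set.mem_ofPred_eq] at hp hp'
            have e := hS (V, S) hp.2
            have e' := hS (V', S') hp'.2
            simp only at e e' h
            refine Prod.ext ?_ (e.trans e'.symm)
            funext i
            by_cases hi : i ∈ T.image Prod.fst
            · have h1 : (i, V i) ∈ selection V' S' := by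
                rw [hp'.2, ← hp.2]
                exact Finset.mem_image_of_mem _ (by rwa [e])
              obtain ⟨j, _, hj⟩ := Finset.mem_image.1 h1
              simp only [Prod.mk.injEq] at hj
              obtain ⟨rfl, hj⟩ := hj
              exact hj.symm
            · have h1 := Finset.ext_iff.1 h i
              simp only [Finset.mem_filter, Finset.mem_compl, hi, not_false_eq_true,
                true_and] at h1
              exact Bool.eq_iff_iff.2 h1
      _ ≤ _ := by
          rw [Finset.card_powerset, Finset.card_compl]
          exact Nat.pow_le_pow_right (by norm_num) (by omega)
  · rw [Finset.card_eq_zero.2]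
    · positivity
    · refine Finset.filter_eq_empty_iff.2 fun p _ hp => hd ?_
      rw [← hS p hp.2]
      exact hp.1

lemma sum_selection_le [Fintype ι] [DecidableEq ι] (d : ℕ) (g : Finset (ι × Bool) → ℝ)
    (hg : ∀ T, 0 ≤ g T) :
    ∑ p : (ι → Bool) × Finset ι, (if d ≤ p.2.card then g (selection p.1 p.2) else 0) ≤
      2 ^ (Fintype.card ι - d) * ∑ T, g T := by
  rw [← Finset.sum_filter, ← Finset.sum_fiberwise _ (fun p => selection p.1 p.2), Finset.mul_sum]
  refine Finset.sum_le_sum fun T _ => ?_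
  rw [Finset.sum_congr rfl (g := fun _ => g T) fun p hp => by rw [(Finset.mem_filter.1 hp).2],
    Finset.sum_const, nsmul_eq_mul, Finset.filter_filter]
  exact mul_le_mul_of_nonneg_right (by exact_mod_cast card_selection_fiber_le d T) (hg T)

/-- The string `x|_V ⊕ w` of a pattern matrix, for `y = (V, w)`. -/
def patternString (x : ι × Bool → Bool) (y : (ι → Bool) × (ι → Bool)) : ι → Bool :=
  fun i => xor (x (i, y.1 i)) (y.2 i)

/-- The spectral norm of a pattern matrix whose generating function has no Fourier weight below
level `d`. -/
theorem bilinBound_pattern [Fintype ι] [DecidableEq ι] {φ : (ι → Bool) → ℝ} {d : ℕ} {δ : ℝ}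
    (h0 : ∀ S : Finset ι, S.card < d → ∑ z, φ z * cubeChar S z = 0)
    (hδ : ∀ S : Finset ι, |∑ z, φ z * cubeChar S z| ≤ δ) :
    BilinBound (fun (x : ι × Bool → Bool) y => (φ (patternString x y) : ℂ))
      ((2 ^ Fintype.card ι)⁻¹ * δ *
        √(2 ^ (Fintype.card ι - d) * 2 ^ (2 * Fintype.card ι) * 2 ^ Fintype.card ι)) := by
  intro u v
  set N := Fintype.card ι
  have hδ0 : 0 ≤ δ := (abs_nonneg _).trans (hδ ∅)
  set F : Finset ι → ℝ := fun S => ∑ z, φ z * cubeChar S z with hF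
  set U : Finset (ι × Bool) → ℂ := fun T => ∑ x, (cubeChar T x : ℂ) * u x with hU
  set W : (ι → Bool) → Finset ι → ℂ := fun V S => ∑ w, (cubeChar S w : ℂ) * v (V, w) with hW
  have key : ∑ x, ∑ y, (φ (patternString x y) : ℂ) * (u x * v y) =
      ((2 ^ N)⁻¹ : ℝ) * ∑ p : (ι → Bool) × Finset ι,
        (F p.2 : ℂ) * (U (selection p.1 p.2) * W p.1 p.2) := by
    have e : ∀ x y, (φ (patternString x y) : ℂ) * (u x * v y) = ((2 ^ N)⁻¹ : ℝ) *
        ∑ S, (F S : ℂ) * ((cubeChar (selection y.1 S) x * u x) * (cubeChar S y.2 * v y)) := by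
      intro x y
      rw [eq_sum_transform φ (patternString x y)]
      push_cast
      rw [mul_assoc, Finset.sum_mul]
      congr 1
      refine Finset.sum_congr rfl fun S _ => ?_
      rw [cubeChar_selection]
      have : cubeChar S (patternString x y) =
          cubeChar S (fun i => x (i, y.1 i)) * cubeChar S y.2 := cubeChar_xor _ _ _
      rw [this]
      simp only [hF]
      push_cast
      ring
    simp only [e, ← Finset.mul_sum]
    congr 1
    rw [Finset.sum_comm, Fintype.sum_prod_type, Fintype.sum_prod_type]
    refine Finset.sum_congr rfl fun V _ => ?_
    calc _ = ∑ w, ∑ S, ∑ x, (F S : ℂ) * ((cubeChar (selection V S) x * u x) *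
        (cubeChar S w * v (V, w))) := Finset.sum_congr rfl fun w _ => Finset.sum_comm
      _ = ∑ S, ∑ w, ∑ x, (F S : ℂ) * ((cubeChar (selection V S) x * u x) *
        (cubeChar S w * v (V, w))) := Finset.sum_comm
      _ = _ := by
        refine Finset.sum_congr rfl fun S _ => ?_
        simp only [hU, hW, ← Finset.mul_sum]
        rw [Finset.sum_mul_sum, Finset.sum_comm]
  rw [key, norm_mul, Complex.norm_real, Real.norm_of_nonneg (by positivity), mul_assoc, mul_assoc]
  refine mul_le_mul_of_nonneg_left ?_ (by positivity)
  have hV2 : ∑ p : (ι → Bool) × Finset ι, ‖W p.1 p.2‖ ^ 2 = 2 ^ N * ∑ y, ‖v y‖ ^ 2 := by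
    rw [Fintype.sum_prod_type, Fintype.sum_prod_type, Finset.mul_sum]
    exact Finset.sum_congr rfl fun V _ => sum_norm_sq_transform fun w => v (V, w)
  have hU2 : ∑ p : (ι → Bool) × Finset ι,
      (if d ≤ p.2.card then ‖U (selection p.1 p.2)‖ else 0) ^ 2 ≤
        2 ^ (N - d) * 2 ^ (2 * N) * ∑ x, ‖u x‖ ^ 2 := by
    have h := sum_selection_le d (fun T => ‖U T‖ ^ 2) fun T => by positivity
    rw [sum_norm_sq_transform, Fintype.card_prod, Fintype.card_bool, ← mul_assoc,
      mul_comm (Fintype.card ι) 2] at h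
    refine le_of_eq_of_le (Finset.sum_congr rfl fun p _ => ?_) h
    split_ifs <;> simp
  calc _ ≤ ∑ p : (ι → Bool) × Finset ι,
        δ * ((if d ≤ p.2.card then ‖U (selection p.1 p.2)‖ else 0) * ‖W p.1 p.2‖) := by
        refine norm_sum_le_of_le _ fun p _ => ?_
        rw [norm_mul, norm_mul, Complex.norm_real, Real.norm_eq_abs]
        split_ifs with hd
        · exact mul_le_mul_of_nonneg_right (hδ _) (by positivity)
        · simp [hF, h0 p.2 (not_le.1 hd)]
    _ ≤ δ * (√(2 ^ (N - d) * 2 ^ (2 * N) * ∑ x, ‖u x‖ ^ 2) * √(2 ^ N * ∑ y, ‖v y‖ ^ 2)) := by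
        rw [← Finset.mul_sum]
        refine mul_le_mul_of_nonneg_left ?_ hδ0
        refine (Real.sum_mul_le_sqrt_mul_sqrt _ _ _).trans ?_
        rw [hV2]
        exact mul_le_mul_of_nonneg_right (Real.sqrt_le_sqrt hU2) (Real.sqrt_nonneg _)
    _ = _ := by
        rw [Real.sqrt_mul (by positivity), Real.sqrt_mul (by positivity) (∑ y, ‖v y‖ ^ 2),
          Real.sqrt_mul (by positivity) (2 ^ N)]
        ring

end Fourier

section Symmetric

variable {t : ℕ}

/-- The monomial `∏ i ∈ T, z i` on the Boolean cube. -/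
def cubeMonomial (T : Finset (Fin t)) (z : Fin t → Bool) : ℝ :=
  if ∀ i ∈ T, z i = true then 1 else 0

lemma cubeChar_eq_sum_monomial (S : Finset (Fin t)) (z : Fin t → Bool) :
    cubeChar S z = ∑ T ∈ S.powerset, (-2) ^ T.card * cubeMonomial T z := by
  have : cubeChar S z = ∏ i ∈ S, (1 + (-2) * if z i = true then 1 else 0) :=
    Finset.prod_congr rfl fun i _ => by cases z i <;> norm_num [bitSign]
  rw [this, Finset.prod_one_add]
  refine Finset.sum_congr rfl fun T _ => ?_
  rw [Finset.prod_mul_distrib, Finset.prod_const, cubeMonomial]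
  congr 1
  split_ifs with h
  · exact Finset.prod_eq_one fun i hi => by simp [h i hi]
  · push Not at h
    obtain ⟨i, hi, h⟩ := h
    exact Finset.prod_eq_zero hi (by simp [h])

lemma card_weight_superset (T : Finset (Fin t)) (k : ℕ) :
    (Finset.univ.filter fun z : Fin t → Bool => weight z = k ∧ ∀ i ∈ T, z i = true).card *
      t.choose T.card = t.choose k * k.choose T.card := by
  by_cases hk : T.card ≤ k
  · have : (Finset.univ.filter fun z : Fin t → Bool => weight z = k ∧ ∀ i ∈ T, z i = true).card =
        (Finset.powersetCard (k - T.card) Tᶜ).card := by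
      refine Finset.card_nbij' (fun z => (Finset.univ.filter fun i => z i = true) \ T)
        (fun A i => decide (i ∈ A ∪ T)) ?_ ?_ ?_ ?_
      · intro z hz
        simp only [Finset.coe_filter, Finset.mem_univ, true_and, Set.mem_ofPred_eq] at hz
        have hT : T ⊆ Finset.univ.filter fun i => z i = true := fun i hi => by simp [hz.2 i hi]
        simp only [Finset.mem_coe, Finset.mem_powersetCard]
        refine ⟨fun i hi => ?_, ?_⟩
        · simp only [Finset.mem_sdiff] at hi
          simp [hi.2]
        · rw [Finset.card_sdiff_of_subset hT, ← hz.1]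
          rfl
      · intro A hA
        simp only [Finset.mem_coe, Finset.mem_powersetCard] at hA
        have hd : Disjoint A T := Finset.disjoint_left.2 fun i hi =>
          Finset.mem_compl.1 (hA.1 hi)
        refine Finset.mem_coe.2 (Finset.mem_filter.2 ⟨Finset.mem_univ _, ?_, fun i hi =>
          decide_eq_true (Finset.mem_union_right _ hi)⟩)
        rw [weight, show (Finset.univ.filter fun i => decide (i ∈ A ∪ T) = true) = A ∪ T by
            ext; simp,
          Finset.card_union_of_disjoint hd, hA.2]
        omega
      · intro z hz
        simp only [Finset.coe_filter, Finset.mem_univ, true_and, Set.mem_ofPred_eq] at hz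
        funext i
        by_cases hi : i ∈ T <;> simp [hi, hz.2]
      · intro A hA
        simp only [Finset.mem_coe, Finset.mem_powersetCard] at hA
        ext i
        have := fun h => Finset.mem_compl.1 (hA.1 h : i ∈ Tᶜ)
        simp
        tauto
    rw [this, Finset.card_powersetCard, Finset.card_compl, Fintype.card_fin, Nat.choose_mul hk,
      mul_comm]
  · have : (Finset.univ.filter fun z : Fin t → Bool => weight z = k ∧ ∀ i ∈ T, z i = true) = ∅ := by
      refine Finset.filter_eq_empty_iff.2 fun z _ hz => hk ?_
      rw [← hz.1]
      exact Finset.card_le_card fun i hi => by simp [hz.2 i hi]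
    rw [this, Nat.choose_eq_zero_of_lt (not_le.1 hk)]
    simp

lemma weight_le (z : Fin t → Bool) : weight z ≤ t :=
  (Finset.card_le_univ _).trans (by simp)

lemma sum_symmetric_mul_monomial (ψ : ℕ → ℝ) (T : Finset (Fin t)) :
    ∑ z : Fin t → Bool, ψ (weight z) / t.choose (weight z) * cubeMonomial T z =
      ∑ k ∈ Finset.range (t + 1), ψ k * (k.choose T.card / t.choose T.card) := by
  rw [← Finset.sum_fiberwise_of_maps_to (s := Finset.univ) (t := Finset.range (t + 1))
    (g := weight) fun z _ => Finset.mem_range_succ_iff.2 (weight_le z)]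
  refine Finset.sum_congr rfl fun k hk => ?_
  have e : ∑ z ∈ Finset.univ.filter (fun z : Fin t → Bool => weight z = k),
      ψ (weight z) / t.choose (weight z) * cubeMonomial T z =
      ψ k / t.choose k * (Finset.univ.filter fun z : Fin t → Bool =>
        weight z = k ∧ ∀ i ∈ T, z i = true).card := by
    rw [← Finset.filter_filter, Finset.card_filter, Nat.cast_sum, Finset.mul_sum]
    refine Finset.sum_congr rfl fun z hz => ?_
    rw [(Finset.mem_filter.1 hz).2, cubeMonomial]
    push_cast
    rfl
  have h := congrArg (Nat.cast (R := ℝ)) (card_weight_superset T k)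
  push_cast at h
  have h1 : (t.choose k : ℝ) ≠ 0 := by
    exact_mod_cast (Nat.choose_pos (Finset.mem_range_succ_iff.1 hk)).ne'
  have h2 : (t.choose T.card : ℝ) ≠ 0 := by
    exact_mod_cast (Nat.choose_pos (by simpa using Finset.card_le_univ T)).ne'
  rw [e]
  field_simp
  linear_combination ψ k * h

lemma sum_symmetric (ψ : ℕ → ℝ) :
    ∑ z : Fin t → Bool, ψ (weight z) / t.choose (weight z) =
      ∑ k ∈ Finset.range (t + 1), ψ k := by
  have := sum_symmetric_mul_monomial (t := t) ψ ∅
  simpa [cubeMonomial] using this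

lemma sum_symmetric_mul_cubeChar_eq_zero {ψ : ℕ → ℝ} {d : ℕ}
    (hψ : ∀ p : Polynomial ℝ, p.natDegree < d →
      ∑ k ∈ Finset.range (t + 1), ψ k * p.eval (k : ℝ) = 0)
    (S : Finset (Fin t)) (hS : S.card < d) :
    ∑ z : Fin t → Bool, ψ (weight z) / t.choose (weight z) * cubeChar S z = 0 := by
  simp only [cubeChar_eq_sum_monomial, Finset.mul_sum]
  rw [Finset.sum_comm]
  refine Finset.sum_eq_zero fun T hT => ?_
  have hT' : T.card < d := (Finset.card_le_card (Finset.mem_powerset.1 hT)).trans_lt hS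
  have h1 := hψ (descPochhammer ℝ T.card) (by rwa [descPochhammer_natDegree])
  have h2 : ∑ z : Fin t → Bool, ψ (weight z) / t.choose (weight z) * cubeMonomial T z = 0 := by
    rw [sum_symmetric_mul_monomial]
    simp only [descPochhammer_eval_eq_descFactorial, Nat.descFactorial_eq_factorial_mul_choose,
      Nat.cast_mul] at h1
    have h3 : ∑ k ∈ Finset.range (t + 1), ψ k * (k.choose T.card / t.choose T.card) =
        (∑ k ∈ Finset.range (t + 1), ψ k * (T.card.factorial * k.choose T.card)) *
          ((T.card.factorial : ℝ)⁻¹ * (t.choose T.card : ℝ)⁻¹) := by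
      rw [Finset.sum_mul]
      refine Finset.sum_congr rfl fun k _ => ?_
      have : (T.card.factorial : ℝ) ≠ 0 := by positivity
      field_simp
    rw [h3, h1, zero_mul]
  rw [← mul_zero ((-2 : ℝ) ^ T.card), ← h2, Finset.mul_sum]
  exact Finset.sum_congr rfl fun z _ => by ring

lemma abs_cubeChar {ι : Type*} (S : Finset ι) (z : ι → Bool) : |cubeChar S z| = 1 := by
  rw [cubeChar, Finset.abs_prod]
  exact Finset.prod_eq_one fun i _ => by cases z i <;> simp [bitSign]

lemma abs_sum_symmetric_mul_cubeChar_le (ψ : ℕ → ℝ) (S : Finset (Fin t)) :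
    |∑ z : Fin t → Bool, ψ (weight z) / t.choose (weight z) * cubeChar S z| ≤
      ∑ k ∈ Finset.range (t + 1), |ψ k| := by
  rw [← sum_symmetric (fun k => |ψ k|)]
  refine (Finset.abs_sum_le_sum_abs _ _).trans (Finset.sum_le_sum fun z _ => ?_)
  rw [abs_mul, abs_cubeChar, mul_one, abs_div, Nat.abs_cast]

end Symmetric

section DualPolynomial

/-- The points `16 l`, `|l| ≤ J`. -/
noncomputable def lattice (J : ℕ) : Finset ℤ := (Finset.Icc (-(J : ℤ)) J).image fun l => 16 * l

/-- The support of the dual polynomial, translated so that it is centred at `0`. -/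
noncomputable def dualNodes (J : ℕ) : Finset ℤ := insert (-1) (insert 2 (lattice J))

@[to_additive]
lemma prod_Icc_symm {M : Type*} [CommMonoid M] (f : ℤ → M) (J : ℕ) :
    ∏ l ∈ Finset.Icc (-(J : ℤ)) J, f l =
      f 0 * ∏ j ∈ Finset.range J, (f (j + 1) * f (-(j + 1))) := by
  induction J with
  | zero => simp
  | succ J ih =>
    have : Finset.Icc (-((J + 1 : ℕ) : ℤ)) (J + 1 : ℕ) =
        insert ((J : ℤ) + 1) (insert (-((J : ℤ) + 1)) (Finset.Icc (-(J : ℤ)) J)) := by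
      ext x
      simp only [Finset.mem_Icc, Finset.mem_insert]
      omega
    rw [this, Finset.prod_insert, Finset.prod_insert, ih, Finset.prod_range_succ]
    · rw [← mul_assoc, mul_comm, mul_assoc]
    · simp
    · simp only [Finset.mem_insert, Finset.mem_Icc]
      omega

lemma prod_Ico_sub (j : ℤ) (a : ℕ) :
    ∏ l ∈ Finset.Ico (j - a) j, ((j : ℝ) - l) = a.factorial := by
  induction a with
  | zero => simp
  | succ a ih =>
    have : Finset.Ico (j - (a + 1 : ℕ)) j = insert (j - (a + 1 : ℕ)) (Finset.Ico (j - a) j) := by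
      ext x
      simp only [Finset.mem_Ico, Finset.mem_insert]
      omega
    rw [this, Finset.prod_insert (by simp only [Finset.mem_Ico]; omega), ih, Nat.factorial_succ]
    push_cast
    ring

lemma prod_Ioc_sub (j : ℤ) (b : ℕ) :
    ∏ l ∈ Finset.Ioc j (j + b), ((l : ℝ) - j) = b.factorial := by
  induction b with
  | zero => simp
  | succ b ih =>
    have : Finset.Ioc j (j + (b + 1 : ℕ)) = insert (j + (b + 1 : ℕ)) (Finset.Ioc j (j + b)) := by
      ext x
      simp only [Finset.mem_Ioc, Finset.mem_insert]
      omega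
    rw [this, Finset.prod_insert (by simp), ih, Nat.factorial_succ]
    push_cast
    ring

lemma factorial_sq_le {J a b : ℕ} (h : a + b = 2 * J) :
    J.factorial * J.factorial ≤ a.factorial * b.factorial := by
  have h1 := Nat.choose_le_centralBinom b J
  have h2 := Nat.add_choose_mul_factorial_mul_factorial a b
  have h3 := Nat.add_choose_mul_factorial_mul_factorial J J
  rw [h] at h2
  rw [← two_mul, ← Nat.centralBinom_eq_two_mul_choose] at h3
  have h4 : (2 * J).choose b * (a.factorial * b.factorial) ≤
      J.centralBinom * (a.factorial * b.factorial) := Nat.mul_le_mul_right _ h1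
  rw [← mul_assoc, h2, ← h3, mul_assoc] at h4
  exact Nat.le_of_mul_le_mul_left h4 (Nat.centralBinom_pos J)

lemma abs_prod_lattice_ge {J : ℕ} {j : ℤ} (hj : j ∈ Finset.Icc (-(J : ℤ)) J) :
    (J.factorial * J.factorial : ℝ) ≤
      |∏ l ∈ (Finset.Icc (-(J : ℤ)) J).erase j, ((j : ℝ) - l)| := by
  obtain ⟨h1, h2⟩ := Finset.mem_Icc.1 hj
  obtain ⟨a, ha⟩ : ∃ a : ℕ, (a : ℤ) = j + J := ⟨(j + J).toNat, by omega⟩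
  obtain ⟨b, hb⟩ : ∃ b : ℕ, (b : ℤ) = J - j := ⟨(J - j).toNat, by omega⟩
  have hs : (Finset.Icc (-(J : ℤ)) J).erase j =
      Finset.Ico (j - a) j ∪ Finset.Ioc j (j + b) := by
    ext x
    simp only [Finset.mem_erase, Finset.mem_Icc, Finset.mem_union, Finset.mem_Ico, Finset.mem_Ioc]
    omega
  have hd : Disjoint (Finset.Ico (j - a) j) (Finset.Ioc j (j + b)) :=
    Finset.disjoint_left.2 fun x hx hx' => by
      simp only [Finset.mem_Ico, Finset.mem_Ioc] at hx hx'
      omega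
  rw [hs, Finset.prod_union hd, abs_mul, prod_Ico_sub, Finset.abs_prod (Finset.Ioc j (j + b))]
  simp only [abs_sub_comm (j : ℝ)]
  rw [← Finset.abs_prod, prod_Ioc_sub, Nat.abs_cast, Nat.abs_cast]
  exact_mod_cast factorial_sq_le (by omega)

/-- The product `∏ (x² - (16 j)²)` over `1 ≤ j ≤ J`. -/
noncomputable def latticePoly (J : ℕ) (x : ℝ) : ℝ :=
  ∏ j ∈ Finset.range J, (x ^ 2 - (16 * (j + 1)) ^ 2)

lemma prod_lattice_sub (J : ℕ) (x : ℝ) :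
    ∏ r ∈ lattice J, (x - r) = x * latticePoly J x := by
  rw [lattice, Finset.prod_image fun a _ b _ h => by simpa using h,
    prod_Icc_symm (fun l : ℤ => x - ((16 * l : ℤ) : ℝ)), latticePoly]
  simp only [mul_zero, Int.cast_zero, sub_zero]
  congr 1
  refine Finset.prod_congr rfl fun j _ => ?_
  push_cast
  ring

lemma prod_lattice_erase (J : ℕ) (j : ℤ) :
    ∏ r ∈ (lattice J).erase (16 * j), (((16 * j : ℤ) : ℝ) - r) =
      ∏ l ∈ (Finset.Icc (-(J : ℤ)) J).erase j, (16 * ((j : ℝ) - l)) := by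
  have : (lattice J).erase (16 * j) =
      ((Finset.Icc (-(J : ℤ)) J).erase j).image fun l => 16 * l := by
    ext x
    simp only [lattice, Finset.mem_erase, Finset.mem_image]
    constructor
    · rintro ⟨h, l, hl, rfl⟩
      exact ⟨l, ⟨fun e => h (by rw [e]), hl⟩, rfl⟩
    · rintro ⟨l, ⟨h, hl⟩, rfl⟩
      exact ⟨fun e => h (by omega), l, hl, rfl⟩
  rw [this, Finset.prod_image fun a _ b _ h => by simpa using h]
  refine Finset.prod_congr rfl fun l _ => ?_
  push_cast
  ring

lemma latticePoly_zero_ne (J : ℕ) : latticePoly J 0 ≠ 0 :=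
  Finset.prod_ne_zero_iff.2 fun j _ => by
    have : (0 : ℝ) < (16 * (j + 1)) ^ 2 := by positivity
    rw [zero_pow two_ne_zero, zero_sub]
    exact (neg_neg_of_pos this).ne

lemma abs_latticePoly_zero (J : ℕ) :
    |latticePoly J 0| = 16 ^ (2 * J) * (J.factorial * J.factorial) := by
  rw [latticePoly, Finset.abs_prod]
  induction J with
  | zero => simp
  | succ J ih =>
    rw [Finset.prod_range_succ, ih, Nat.factorial_succ, zero_pow two_ne_zero, zero_sub, abs_neg,
      abs_of_nonneg (by positivity)]
    push_cast
    ring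

/-- The ratio of `latticePoly` at `x` and at `0`. -/
noncomputable def latticeRatio (J : ℕ) (x : ℝ) : ℝ :=
  ∏ j ∈ Finset.range J, (1 - x ^ 2 / (16 * (j + 1)) ^ 2)

lemma latticePoly_eq (J : ℕ) (x : ℝ) : latticePoly J x = latticePoly J 0 * latticeRatio J x := by
  rw [latticePoly, latticePoly, latticeRatio, ← Finset.prod_mul_distrib]
  refine Finset.prod_congr rfl fun j _ => ?_
  have : (16 * ((j : ℝ) + 1)) ≠ 0 := by positivity
  field_simp
  ring

lemma sum_inv_sq_le (J : ℕ) :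
    ∑ j ∈ Finset.range J, 1 / ((j : ℝ) + 1) ^ 2 ≤ 2 - 1 / (J : ℝ) := by
  induction J with
  | zero => norm_num
  | succ J ih =>
    rw [Finset.sum_range_succ]
    rcases Nat.eq_zero_or_pos J with rfl | hJ
    · norm_num
    · have hJ' : (0 : ℝ) < J := by exact_mod_cast hJ
      have : 1 / ((J : ℝ) + 1) ^ 2 ≤ 1 / (J : ℝ) - 1 / ((J : ℝ) + 1) := by
        rw [div_sub_div _ _ hJ'.ne' (by positivity),
          div_le_div_iff₀ (by positivity) (by positivity)]
        nlinarith
      push_cast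
      linarith

lemma one_sub_sum_le_prod (s : Finset ℕ) (f : ℕ → ℝ) (h0 : ∀ i, 0 ≤ f i) (h1 : ∀ i, f i ≤ 1) :
    1 - ∑ i ∈ s, f i ≤ ∏ i ∈ s, (1 - f i) := by
  induction s using Finset.induction_on with
  | empty => simp
  | insert a s ha ih =>
    rw [Finset.sum_insert ha, Finset.prod_insert ha]
    have : 0 ≤ ∑ i ∈ s, f i := Finset.sum_nonneg fun i _ => h0 i
    have h2 : (1 - f a) * (1 - ∑ i ∈ s, f i) ≤ (1 - f a) * ∏ i ∈ s, (1 - f i) :=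
      mul_le_mul_of_nonneg_left ih (sub_nonneg.2 (h1 a))
    nlinarith [mul_nonneg (h0 a) this]

lemma latticeRatio_neg_one_pos (J : ℕ) : 0 < latticeRatio J (-1) := by
  refine Finset.prod_pos fun j _ => ?_
  rw [sub_pos, div_lt_one (by positivity)]
  nlinarith [(Nat.cast_nonneg j : (0 : ℝ) ≤ j)]

lemma latticeRatio_neg_one_le (J : ℕ) : latticeRatio J (-1) ≤ 1 := by
  refine Finset.prod_le_one (fun j _ => ?_) fun j _ => ?_
  · rw [sub_nonneg, div_le_one (by positivity)]
    nlinarith [(Nat.cast_nonneg j : (0 : ℝ) ≤ j)]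
  · rw [sub_le_self_iff]
    positivity

lemma le_latticeRatio_two (J : ℕ) : 31 / 32 ≤ latticeRatio J 2 := by
  refine le_trans ?_ (one_sub_sum_le_prod _ _ (fun j => by positivity) fun j => ?_)
  · have h : ∑ j ∈ Finset.range J, (2 : ℝ) ^ 2 / (16 * ((j : ℝ) + 1)) ^ 2 =
        1 / 64 * ∑ j ∈ Finset.range J, 1 / ((j : ℝ) + 1) ^ 2 := by
      rw [Finset.mul_sum]
      refine Finset.sum_congr rfl fun j _ => ?_
      field_simp
      norm_num
    have h2 := sum_inv_sq_le J
    have h3 : 0 ≤ 1 / (J : ℝ) := by positivity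
    rw [h]
    linarith
  · rw [div_le_one (by positivity)]
    nlinarith [(Nat.cast_nonneg j : (0 : ℝ) ≤ j)]

/-- The dual polynomial on its support. -/
noncomputable def dualWeight (J : ℕ) (i : ℤ) : ℝ :=
  -latticePoly J 0 / ∏ r ∈ (dualNodes J).erase i, ((i : ℝ) - r)

lemma mem_lattice_dvd {J : ℕ} {i : ℤ} (h : i ∈ lattice J) : 16 ∣ i := by
  obtain ⟨l, _, rfl⟩ := Finset.mem_image.1 h
  exact ⟨l, rfl⟩

lemma neg_one_notMem (J : ℕ) : (-1 : ℤ) ∉ insert 2 (lattice J) := by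
  intro h
  rcases Finset.mem_insert.1 h with h | h
  · omega
  · have := mem_lattice_dvd h
    omega

lemma two_notMem (J : ℕ) : (2 : ℤ) ∉ lattice J := fun h => by
  have := mem_lattice_dvd h
  omega

lemma card_dualNodes (J : ℕ) : (dualNodes J).card = 2 * J + 3 := by
  rw [dualNodes, Finset.card_insert_of_notMem (neg_one_notMem J),
    Finset.card_insert_of_notMem (two_notMem J), lattice,
    Finset.card_image_of_injective _ fun a b h => by simpa using h, Int.card_Icc]
  omega

lemma dualWeight_neg_one (J : ℕ) : dualWeight J (-1) = -1 / (3 * latticeRatio J (-1)) := by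
  have h := latticePoly_zero_ne J
  have h2 := (latticeRatio_neg_one_pos J).ne'
  rw [dualWeight, dualNodes, Finset.erase_insert (neg_one_notMem J),
    Finset.prod_insert (two_notMem J), prod_lattice_sub]
  push_cast
  rw [latticePoly_eq J (-1)]
  field_simp
  norm_num

lemma dualWeight_two (J : ℕ) : dualWeight J 2 = -1 / (6 * latticeRatio J 2) := by
  have h := latticePoly_zero_ne J
  have h2 : latticeRatio J 2 ≠ 0 := by linarith [le_latticeRatio_two J]
  have h3 : (dualNodes J).erase 2 = insert (-1) (lattice J) := by
    rw [dualNodes, Finset.erase_insert_of_ne (by norm_num), Finset.erase_insert (two_notMem J)]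
  rw [dualWeight, h3,
    Finset.prod_insert fun h => neg_one_notMem J (Finset.mem_insert_of_mem h), prod_lattice_sub]
  push_cast
  rw [latticePoly_eq J 2]
  field_simp
  norm_num

lemma dualWeight_lattice (J : ℕ) (j : ℤ) : dualWeight J (16 * j) =
    -latticePoly J 0 / ((16 * j + 1) * ((16 * j - 2) *
      ∏ l ∈ (Finset.Icc (-(J : ℤ)) J).erase j, (16 * ((j : ℝ) - l)))) := by
  have h3 : (dualNodes J).erase (16 * j) = insert (-1) (insert 2 ((lattice J).erase (16 * j))) := by
    rw [dualNodes, Finset.erase_insert_of_ne (by omega), Finset.erase_insert_of_ne (by omega)]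
  rw [dualWeight, h3, Finset.prod_insert, Finset.prod_insert, prod_lattice_erase]
  · push_cast
    ring
  · exact fun h => two_notMem J (Finset.mem_of_mem_erase h)
  · intro h
    rcases Finset.mem_insert.1 h with h | h
    · omega
    · exact neg_one_notMem J (Finset.mem_insert_of_mem (Finset.mem_of_mem_erase h))

lemma dualWeight_zero (J : ℕ) : dualWeight J 0 = 1 / 2 := by
  have h := dualWeight_lattice J 0
  have h2 : ∏ l ∈ (Finset.Icc (-(J : ℤ)) J).erase 0, (16 * (((0 : ℤ) : ℝ) - l)) =
      latticePoly J 0 := by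
    have h3 := prod_Icc_symm (fun l : ℤ => if l = 0 then (1 : ℝ) else 16 * (((0 : ℤ) : ℝ) - l)) J
    rw [← Finset.mul_prod_erase _ _ (Finset.mem_Icc.2 ⟨by simp, by simp⟩ :
      (0 : ℤ) ∈ Finset.Icc (-(J : ℤ)) J)] at h3
    simp only [if_true, one_mul] at h3
    rw [Finset.prod_congr rfl (g := fun l : ℤ => if l = 0 then (1 : ℝ) else
      16 * (((0 : ℤ) : ℝ) - l)) fun l hl => by rw [if_neg (Finset.ne_of_mem_erase hl)], h3,
      latticePoly]
    refine Finset.prod_congr rfl fun j _ => ?_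
    rw [if_neg (by omega), if_neg (by omega)]
    push_cast
    ring
  have h3 := latticePoly_zero_ne J
  rw [h2] at h
  simp only [mul_zero, Int.cast_zero] at h
  rw [h]
  field_simp
  norm_num

lemma abs_dualWeight_lattice_le {J : ℕ} {j : ℤ} (hj : j ∈ Finset.Icc (-(J : ℤ)) J) (h0 : j ≠ 0) :
    |dualWeight J (16 * j)| ≤ 1 / 238 * (1 / (j : ℝ) ^ 2) := by
  have h1 : 238 * (j : ℝ) ^ 2 ≤ |(16 * (j : ℝ) + 1) * (16 * j - 2)| := by
    have : 238 * j ^ 2 ≤ (16 * j + 1) * (16 * j - 2) := by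
      rcases lt_or_gt_of_ne h0 with h | h
      · nlinarith
      · nlinarith
    exact le_trans (by exact_mod_cast this) (le_abs_self _)
  have h2 : |latticePoly J 0| ≤
      |∏ l ∈ (Finset.Icc (-(J : ℤ)) J).erase j, (16 * ((j : ℝ) - l))| := by
    rw [Finset.prod_mul_distrib, abs_mul, Finset.prod_const, Finset.card_erase_of_mem hj,
      Int.card_Icc, abs_latticePoly_zero,
      show ((J : ℤ) + 1 - -(J : ℤ)).toNat - 1 = 2 * J by omega,
      abs_of_nonneg (by positivity : (0 : ℝ) ≤ 16 ^ (2 * J))]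
    exact mul_le_mul_of_nonneg_left (abs_prod_lattice_ge hj) (by positivity)
  have h3 : 0 < |latticePoly J 0| := abs_pos.2 (latticePoly_zero_ne J)
  have hj2 : 0 < (j : ℝ) ^ 2 := by positivity
  rw [dualWeight_lattice, ← mul_assoc, abs_div, abs_neg, abs_mul,
    one_div_mul_one_div, div_le_div_iff₀ (mul_pos (by linarith) (by linarith)) (by positivity),
    one_mul, mul_comm]
  exact mul_le_mul h1 h2 h3.le (abs_nonneg _)

lemma sum_abs_dualWeight_le (J : ℕ) :
    ∑ i ∈ dualNodes J, |dualWeight J i| ≤ 5 / 4 * (dualWeight J 0 - dualWeight J (-1)) := by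
  have hr := latticeRatio_neg_one_pos J
  have h1 : 1 / 3 ≤ -dualWeight J (-1) := by
    rw [dualWeight_neg_one, neg_div, neg_neg]
    exact one_div_le_one_div_of_le (by positivity) (by linarith [latticeRatio_neg_one_le J])
  have h2 : |dualWeight J 2| ≤ 16 / 93 := by
    have := le_latticeRatio_two J
    rw [dualWeight_two, abs_div, abs_neg, abs_one, abs_of_pos (by linarith),
      div_le_div_iff₀ (by linarith) (by norm_num)]
    linarith
  have h3 : ∑ i ∈ lattice J, |dualWeight J i| ≤ 1 / 2 + 4 / 238 := by
    rw [lattice, Finset.sum_image fun a _ b _ h => by simpa using h, sum_Icc_symm,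
      mul_zero, dualWeight_zero, abs_of_pos (by norm_num)]
    have h4 : ∀ j ∈ Finset.range J, |dualWeight J (16 * ((j : ℤ) + 1))| +
        |dualWeight J (16 * (-((j : ℤ) + 1)))| ≤ 2 / 238 * (1 / ((j : ℝ) + 1) ^ 2) := by
      intro j hj
      have hj := Finset.mem_range.1 hj
      have a1 := abs_dualWeight_lattice_le (J := J) (j := (j : ℤ) + 1)
        (Finset.mem_Icc.2 ⟨by omega, by omega⟩) (by omega)
      have a2 := abs_dualWeight_lattice_le (J := J) (j := -((j : ℤ) + 1))
        (Finset.mem_Icc.2 ⟨by omega, by omega⟩) (by omega)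
      push_cast at a1 a2
      rw [neg_sq] at a2
      linarith
    have h5 := Finset.sum_le_sum h4
    rw [← Finset.mul_sum] at h5
    have h6 := sum_inv_sq_le J
    have h7 : 0 ≤ 1 / (J : ℝ) := by positivity
    linarith
  have h0 := dualWeight_zero J
  rw [dualNodes, Finset.sum_insert (neg_one_notMem J), Finset.sum_insert (two_notMem J),
    abs_of_neg (by linarith)]
  linarith

lemma sum_dualWeight_mul_eval (J : ℕ) (p : Polynomial ℝ) (hp : p.natDegree < 2 * J + 2) :
    ∑ i ∈ dualNodes J, dualWeight J i * p.eval (i : ℝ) = 0 := by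
  have h := Lagrange.coeff_eq_sum (s := dualNodes J) (v := fun i : ℤ => (i : ℝ))
    (fun a _ b _ h => Int.cast_injective h) (P := p)
    (lt_of_le_of_lt Polynomial.degree_le_natDegree (by
      rw [card_dualNodes]
      exact_mod_cast (by omega : p.natDegree < 2 * J + 3)))
  rw [card_dualNodes, Polynomial.coeff_eq_zero_of_natDegree_lt (by omega)] at h
  have h2 := congrArg (fun c => -latticePoly J 0 * c) h
  simp only [mul_zero, Finset.mul_sum] at h2
  rw [h2]
  refine Finset.sum_congr rfl fun i _ => ?_
  rw [dualWeight]
  ring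

lemma dualNodes_subset {J m : ℕ} (hJ : 16 * J ≤ m) (hm : 2 ≤ m) {i : ℤ} (hi : i ∈ dualNodes J) :
    -(m : ℤ) ≤ i ∧ i ≤ m := by
  simp only [dualNodes, lattice, Finset.mem_insert, Finset.mem_image, Finset.mem_Icc] at hi
  rcases hi with rfl | rfl | ⟨l, hl, rfl⟩ <;> omega

lemma sum_translate {s : Finset ℤ} {m : ℕ} (hs : ∀ i ∈ s, -(m : ℤ) ≤ i ∧ i ≤ m) (g : ℤ → ℝ) :
    ∑ k ∈ Finset.range (2 * m + 1), (if (k : ℤ) - m ∈ s then g (k - m) else 0) = ∑ i ∈ s, g i := by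
  rw [← Finset.sum_filter]
  refine Finset.sum_nbij' (fun k => (k : ℤ) - m) (fun i => (i + m).toNat) ?_ ?_ ?_ ?_ ?_
  · intro k hk
    exact (Finset.mem_filter.1 hk).2
  · intro i hi
    have := hs i hi
    refine Finset.mem_filter.2 ⟨Finset.mem_range.2 (by omega), ?_⟩
    rwa [show (((i + m).toNat : ℕ) : ℤ) - m = i by omega]
  · intro k _
    simp
  · intro i hi
    have := hs i hi
    omega
  · intro k _
    rfl

/-- A dual polynomial for distinguishing the weights `m` and `m - 1` on `2m` bits. -/
theorem exists_dual_polynomial {J m : ℕ} (hJ : 16 * J ≤ m) (hm : 2 ≤ m) :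
    ∃ ψ : ℕ → ℝ, (∀ p : Polynomial ℝ, p.natDegree < 2 * J + 2 →
        ∑ k ∈ Finset.range (2 * m + 1), ψ k * p.eval (k : ℝ) = 0) ∧
      0 < ψ m ∧ ψ (m - 1) < 0 ∧
      ∑ k ∈ Finset.range (2 * m + 1), |ψ k| ≤ 5 / 4 * (ψ m - ψ (m - 1)) := by
  have hs := fun i (hi : i ∈ dualNodes J) => dualNodes_subset hJ hm hi
  refine ⟨fun k => if (k : ℤ) - m ∈ dualNodes J then dualWeight J (k - m) else 0, ?_, ?_⟩
  · intro p hp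
    have h := sum_dualWeight_mul_eval J (p.comp (Polynomial.X + Polynomial.C (m : ℝ)))
      (by rwa [Polynomial.natDegree_comp, Polynomial.natDegree_X_add_C, mul_one])
    refine Eq.trans ?_ h
    rw [← sum_translate hs]
    refine Finset.sum_congr rfl fun k _ => ?_
    simp
  have e0 : (if (m : ℤ) - m ∈ dualNodes J then dualWeight J (m - m) else 0) = dualWeight J 0 := by
    rw [sub_self, if_pos]
    simp [dualNodes, lattice]
  have e1 : (if ((m - 1 : ℕ) : ℤ) - m ∈ dualNodes J then dualWeight J ((m - 1 : ℕ) - m) else 0) =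
      dualWeight J (-1) := by
    rw [show ((m - 1 : ℕ) : ℤ) - m = -1 by omega, if_pos]
    simp [dualNodes]
  simp only [e0, e1]
  refine ⟨?_, ?_, ?_⟩
  · rw [dualWeight_zero]
    norm_num
  · rw [dualWeight_neg_one, neg_div]
    have := latticeRatio_neg_one_pos J
    exact neg_neg_of_pos (by positivity)
  · refine le_of_eq_of_le ?_ (sum_abs_dualWeight_le J)
    rw [← sum_translate hs]
    refine Finset.sum_congr rfl fun k _ => ?_
    split_ifs <;> simp

end DualPolynomial

section Embedding

variable {n t p q s r : ℕ}

/-- Blocks of four positions, followed by padding positions of four kinds. -/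
abbrev PaddedIndex (t p q s r : ℕ) : Type :=
  (Fin t × Bool × Bool) ⊕ (Fin p ⊕ Fin q ⊕ Fin s ⊕ Fin r)

/-- Alice's input: `x (i, v)` is encoded by exactly one of the positions `(i, v, ·)`. -/
def aliceInput (e : Fin n ≃ PaddedIndex t p q s r) (x : Fin t × Bool → Bool) (a : Fin n) : Bool :=
  match e a with
  | .inl (i, v, c) => x (i, v) == c
  | .inr (.inl _) => true
  | .inr (.inr (.inl _)) => true
  | .inr (.inr (.inr (.inl _))) => false
  | .inr (.inr (.inr (.inr _))) => false

/-- Bob's input: `(V i, w i)` is encoded by exactly one of the positions `(i, ·, ·)`. -/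
def bobInput (e : Fin n ≃ PaddedIndex t p q s r) (y : (Fin t → Bool) × (Fin t → Bool))
    (a : Fin n) : Bool :=
  match e a with
  | .inl (i, v, c) => v == y.1 i && c == !y.2 i
  | .inr (.inl _) => true
  | .inr (.inr (.inl _)) => false
  | .inr (.inr (.inr (.inl _))) => true
  | .inr (.inr (.inr (.inr _))) => false

lemma weight_aliceInput (e : Fin n ≃ PaddedIndex t p q s r) (x : Fin t × Bool → Bool) :
    weight (aliceInput e x) = 2 * t + p + q := by
  rw [weight, Finset.card_filter, ← Equiv.sum_comp e.symm]
  simp only [aliceInput, Equiv.apply_symm_apply, Fintype.sum_sum_type, Fintype.sum_prod_type,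
    Fintype.sum_bool]
  rw [Finset.sum_congr rfl (g := fun _ => 2) fun i _ => by
    rcases Bool.eq_false_or_eq_true (x (i, true)) with h | h <;>
      rcases Bool.eq_false_or_eq_true (x (i, false)) with h' | h' <;> simp [h, h']]
  simp
  ring

lemma weight_bobInput (e : Fin n ≃ PaddedIndex t p q s r) (y : (Fin t → Bool) × (Fin t → Bool)) :
    weight (bobInput e y) = t + p + s := by
  rw [weight, Finset.card_filter, ← Equiv.sum_comp e.symm]
  simp only [bobInput, Equiv.apply_symm_apply, Fintype.sum_sum_type, Fintype.sum_prod_type,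
    Fintype.sum_bool]
  rw [Finset.sum_congr rfl (g := fun _ => 1) fun i _ => by
    rcases Bool.eq_false_or_eq_true (y.1 i) with h | h <;>
      rcases Bool.eq_false_or_eq_true (y.2 i) with h' | h' <;> simp [h, h']]
  simp
  ring

lemma interCard_inputs (e : Fin n ≃ PaddedIndex t p q s r) (x : Fin t × Bool → Bool)
    (y : (Fin t → Bool) × (Fin t → Bool)) :
    interCard (aliceInput e x) (bobInput e y) = weight (patternString x y) + p := by
  rw [interCard, Finset.card_filter, ← Equiv.sum_comp e.symm, weight, Finset.card_filter]
  simp only [aliceInput, bobInput, Equiv.apply_symm_apply, Fintype.sum_sum_type,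
    Fintype.sum_prod_type, Fintype.sum_bool]
  congr 1
  · refine Finset.sum_congr rfl fun i _ => ?_
    simp only [patternString]
    rcases Bool.eq_false_or_eq_true (y.1 i) with h | h <;>
      rcases Bool.eq_false_or_eq_true (y.2 i) with h' | h' <;> simp [h, h']
  · simp

end Embedding

lemma sum_patternString {t : ℕ} (h : (Fin t → Bool) → ℝ) :
    ∑ x : Fin t × Bool → Bool, ∑ y, h (patternString x y) = 8 ^ t * ∑ z, h z := by
  have e : ∀ (x : Fin t × Bool → Bool) (V : Fin t → Bool),
      ∑ w, h (patternString x (V, w)) = ∑ z, h z := by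
    intro x V
    refine Fintype.sum_equiv (Function.Involutive.toPerm
      (fun w i => xor (x (i, V i)) (w i)) fun w => ?_) _ _ fun w => rfl
    funext i
    simp
  simp only [Fintype.sum_prod_type, e, Finset.sum_const, Finset.card_univ, Fintype.card_fun,
    Fintype.card_prod, Fintype.card_bool, Fintype.card_fin, nsmul_eq_mul]
  push_cast
  rw [← mul_assoc, show (8 : ℝ) = 2 ^ 3 by norm_num, ← pow_mul, ← pow_add]
  congr 2
  ring

lemma sum_signed_dual_ge {ψ : ℕ → ℝ} {m : ℕ} (hm : 1 ≤ m)
    (hψ : ∑ k ∈ Finset.range (2 * m + 1), |ψ k| ≤ 5 / 4 * (ψ m - ψ (m - 1)))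
    (h0 : 0 < ψ m) (h1 : ψ (m - 1) < 0) :
    (ψ m - ψ (m - 1)) / 12 ≤ ∑ k ∈ Finset.range (2 * m + 1),
      (if k = m ∨ k = m - 1 then |ψ k| / 3 else -|ψ k|) := by
  have e : ∀ k, (if k = m ∨ k = m - 1 then |ψ k| / 3 else -|ψ k|) =
      -|ψ k| + ((if k = m then 4 / 3 * ψ m else 0) +
        if k = m - 1 then -(4 / 3 * ψ (m - 1)) else 0) := by
    intro k
    by_cases hk : k = m
    · subst hk
      rw [if_pos (Or.inl rfl), if_pos rfl, if_neg (by omega), abs_of_pos h0]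
      ring
    · by_cases hk' : k = m - 1
      · subst hk'
        rw [if_pos (Or.inr rfl), if_neg hk, if_pos rfl, abs_of_neg h1]
        ring
      · simp [hk, hk']
  simp only [e, Finset.sum_add_distrib, Finset.sum_neg_distrib, Finset.sum_ite_eq',
    Finset.mem_range]
  rw [if_pos (by omega), if_pos (by omega)]
  linarith

lemma mul_two_sub_one_ge {a P : ℝ} (h0 : 0 ≤ P) (h1 : P ≤ 1) : -|a| ≤ a * (2 * P - 1) := by
  have : |a * (2 * P - 1)| ≤ |a| := by
    rw [abs_mul]
    exact mul_le_of_le_one_right (abs_nonneg _) (abs_le.2 ⟨by linarith, by linarith⟩)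
  exact (abs_le.1 this).1.trans' (neg_le_neg le_rfl)

/-- A pattern-matrix lower bound for protocols that compute `gapInter (4 * k)`. -/
theorem EntangledProtocol.pow_le_of_computes {k m J : ℕ} (hk : 3 * m ≤ k) (hJ : 16 * J ≤ m)
    (hm : 2 ≤ m) (P : EntangledProtocol (Fin (4 * k) → Bool) (Fin (4 * k) → Bool))
    (hP : P.Computes (gapInter (4 * k)) (1 / 3)) :
    (2 : ℝ) ^ (J + 1) ≤ 30 * 4 ^ P.protocol.cost := by
  obtain ⟨ψ, horth, h0, h1, hsum⟩ := exists_dual_polynomial hJ hm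
  set M := ψ m - ψ (m - 1) with hM
  have hMpos : 0 < M := by linarith
  let e : Fin (4 * k) ≃ PaddedIndex (2 * m) (k - m) (k - 3 * m) (k - m) (k - 3 * m) :=
    Fintype.equivOfCardEq (by
      simp only [Fintype.card_sum, Fintype.card_prod, Fintype.card_fin, Fintype.card_bool]
      omega)
  set φ : (Fin (2 * m) → Bool) → ℝ := fun z =>
    ψ (weight z) / (2 * m).choose (weight z) with hφ
  set pr : (Fin (2 * m) × Bool → Bool) → ((Fin (2 * m) → Bool) × (Fin (2 * m) → Bool)) → ℝ :=
    fun x y => P.protocol.probNeg P.state (aliceInput e x) (bobInput e y) with hpr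
  have hst : hsSq P.state = 1 := P.unit_state
  have hpr0 : ∀ x y, 0 ≤ pr x y := fun x y => P.protocol.probNeg_nonneg _ _ _
  have hpr1 : ∀ x y, pr x y ≤ 1 := fun x y => (P.protocol.probNeg_le _ _ _).trans_eq hst
  have hcomp : ∀ x y, (weight (patternString x y) = m → 2 / 3 ≤ pr x y) ∧
      (weight (patternString x y) = m - 1 → pr x y ≤ 1 / 3) := by
    intro x y
    have ha := weight_aliceInput e x
    have hb := weight_bobInput e y
    have hi := interCard_inputs e x y
    constructor
    · intro hw
      have h := hP (aliceInput e x) (bobInput e y) (-1) (by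
        rw [gapInter, if_pos ⟨by omega, by omega, by omega⟩])
      rw [outProb, if_pos rfl] at h
      simp only [hpr]
      linarith
    · intro hw
      have h := hP (aliceInput e x) (bobInput e y) 1 (by
        rw [gapInter, if_neg (by omega), if_pos ⟨by omega, by omega, by omega⟩])
      rw [outProb, if_neg (by decide)] at h
      simp only [hpr]
      linarith
  have hlow : 8 ^ (2 * m) * (M / 12) ≤
      ∑ x, ∑ y, φ (patternString x y) * (2 * pr x y - 1) := by
    have h := sum_signed_dual_ge (by omega : 1 ≤ m) hsum h0 h1
    rw [← sum_symmetric (t := 2 * m)] at h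
    refine (mul_le_mul_of_nonneg_left h (by positivity)).trans ?_
    rw [← sum_patternString]
    refine Finset.sum_le_sum fun x _ => Finset.sum_le_sum fun y _ => ?_
    have hc := hcomp x y
    simp only [hφ]
    generalize patternString x y = z at hc ⊢
    rw [div_mul_eq_mul_div]
    refine div_le_div_of_nonneg_right ?_ (by positivity)
    split_ifs with hw
    · rcases hw with hw | hw
      · have := hc.1 hw
        rw [hw, abs_of_pos h0]
        nlinarith
      · have := hc.2 hw
        rw [hw, abs_of_neg h1]
        nlinarith
    · exact mul_two_sub_one_ge (hpr0 x y) (hpr1 x y)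
  have hzero : ∑ x, ∑ y, φ (patternString x y) = 0 := by
    rw [sum_patternString, sum_symmetric]
    have := horth 1 (by simp)
    simp only [Polynomial.eval_one, mul_one] at this
    rw [this, mul_zero]
  have hsplit : ∑ x, ∑ y, φ (patternString x y) * (2 * pr x y - 1) =
      2 * ∑ x, ∑ y, φ (patternString x y) * pr x y := by
    have : ∀ x y, φ (patternString x y) * (2 * pr x y - 1) =
        2 * (φ (patternString x y) * pr x y) - φ (patternString x y) := fun x y => by ring
    simp only [this, Finset.sum_sub_distrib, hzero, Finset.mul_sum, sub_zero]
  have hbil := bilinBound_pattern (φ := φ) (d := 2 * J + 2)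
    (δ := ∑ k ∈ Finset.range (2 * m + 1), |ψ k|)
    (sum_symmetric_mul_cubeChar_eq_zero horth) (abs_sum_symmetric_mul_cubeChar_le ψ)
  have hup := P.protocol.probNeg_correlation_le hbil
    (mul_nonneg (mul_nonneg (by positivity) (Finset.sum_nonneg fun _ _ => abs_nonneg _))
      (Real.sqrt_nonneg _)) (aliceInput e) (bobInput e) P.state hst.le
  have hroot : √(2 ^ (2 * m - (2 * J + 2)) * 2 ^ (2 * (2 * m)) * 2 ^ (2 * m) : ℝ) * 2 ^ (J + 1) =
      2 ^ (4 * m) := by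
    rw [← pow_add, ← pow_add, show 2 * m - (2 * J + 2) + 2 * (2 * m) + 2 * m =
      (4 * m - (J + 1)) * 2 by omega, pow_mul, Real.sqrt_sq (by positivity), ← pow_add]
    congr 1
    omega
  have hX : √(Fintype.card (Fin (2 * m) × Bool → Bool) : ℝ) = 2 ^ (2 * m) := by
    simp only [Fintype.card_fun, Fintype.card_prod, Fintype.card_bool, Fintype.card_fin]
    push_cast
    rw [pow_mul, Real.sqrt_sq (by positivity)]
  have hY : √(Fintype.card ((Fin (2 * m) → Bool) × (Fin (2 * m) → Bool)) : ℝ) = 2 ^ (2 * m) := by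
    simp only [Fintype.card_fun, Fintype.card_prod, Fintype.card_bool, Fintype.card_fin]
    push_cast
    rw [Real.sqrt_mul_self (by positivity)]
  rw [hX, hY, Fintype.card_fin] at hup
  have hup' := (le_abs_self _).trans hup
  rw [hsplit] at hlow
  set R := √(2 ^ (2 * m - (2 * J + 2)) * 2 ^ (2 * (2 * m)) * 2 ^ (2 * m) : ℝ) with hR
  have hR0 : 0 ≤ R := Real.sqrt_nonneg _
  set A := ∑ k ∈ Finset.range (2 * m + 1), |ψ k| with hA
  set c : ℝ := 4 ^ P.protocol.cost with hc
  have hc0 : 0 < c := by positivity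
  have h8 : (8 : ℝ) ^ (2 * m) = 2 ^ (2 * m) * 2 ^ (4 * m) := by
    rw [show (8 : ℝ) = 2 ^ 3 by norm_num, ← pow_mul, ← pow_add]
    congr 1
    omega
  have h2 : (0 : ℝ) < 2 ^ (2 * m) := by positivity
  have h4 : (0 : ℝ) < 2 ^ (4 * m) := by positivity
  have h5 : 2 ^ (2 * m) * 2 ^ (4 * m) * (M / 12) ≤ 2 * (c * A * R * 2 ^ (2 * m)) := by
    rw [← h8]
    refine hlow.trans (mul_le_mul_of_nonneg_left (hup'.trans (le_of_eq ?_)) (by norm_num))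
    field_simp
  have h6 : 2 ^ (4 * m) * (M / 12) ≤ 2 * (c * A * R) :=
    le_of_mul_le_mul_left (by linarith) h2
  have h7 : 2 * (c * A * R) ≤ 5 / 2 * c * M * R := by
    have := mul_le_mul_of_nonneg_left hsum (mul_nonneg hc0.le hR0)
    linarith
  have h9 : 2 ^ (4 * m) * M * 2 ^ (J + 1) ≤ 2 ^ (4 * m) * M * (30 * c) := by
    have := mul_le_mul_of_nonneg_right (h6.trans h7) (by positivity : (0 : ℝ) ≤ 12 * 2 ^ (J + 1))
    have e : 5 / 2 * c * M * R * (12 * 2 ^ (J + 1)) = 30 * c * M * (R * 2 ^ (J + 1)) := by ring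
    rw [e, hroot] at this
    linarith
  exact le_of_mul_le_mul_left h9 (by positivity)

lemma EntangledProtocol.le_cost_of_computes {n : ℕ} (hn : 10000 ≤ n) (h4 : 4 ∣ n)
    (P : EntangledProtocol (Fin n → Bool) (Fin n → Bool)) (hP : P.Computes (gapInter n) (1 / 3)) :
    n ≤ 1000 * P.protocol.cost := by
  obtain ⟨k, rfl⟩ := h4
  have h := P.pow_le_of_computes (m := k / 3) (J := k / 3 / 16) (by omega) (by omega) (by omega) hP
  have h2 : (2 : ℝ) ^ (k / 3 / 16 + 1) ≤ 2 ^ (5 + 2 * P.protocol.cost) := by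
    refine h.trans ?_
    rw [pow_add, pow_mul]
    norm_num
  have h3 := (pow_le_pow_iff_right₀ (by norm_num : (1 : ℝ) < 2)).1 h2
  omega

end QComm

theorem theorem4 :
    ∃ c : ℝ≥0, 0 < c ∧ ∃ N : ℕ, ∀ n : ℕ, N ≤ n → 4 ∣ n →
      (c : ℝ≥0∞) * (n : ℝ≥0∞) ≤ (QComm.qStar (1 / 3) (QComm.gapInter n) : ℝ≥0∞) := by
  refine ⟨1 / 1000, by norm_num, 10000, fun n hn h4 => ?_⟩
  have h1 : (((n + 999) / 1000 : ℕ) : ℕ∞) ≤ QComm.qStar (1 / 3) (QComm.gapInter n) :=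
    le_iInf₂ fun P hP => by
      have := P.le_cost_of_computes hn h4 hP
      exact_mod_cast (by omega : (n + 999) / 1000 ≤ P.protocol.cost)
  refine le_trans ?_ (ENat.toENNReal_le.2 h1)
  have h2 : (n : ℝ≥0) ≤ 1000 * ((n + 999) / 1000 : ℕ) := by
    exact_mod_cast (by omega : n ≤ 1000 * ((n + 999) / 1000))
  have h3 : (1 / 1000 : ℝ≥0) * n ≤ ((n + 999) / 1000 : ℕ) := by
    rw [one_div, inv_mul_le_iff₀ (by norm_num)]
    exact h2
  rw [ENat.toENNReal_coe]
  exact_mod_cast h3
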